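/- Let $\log=\log_2$. For a sequence $s$ of $n$ elements of a linearly ordered set let $\sigma$ be the number of distinct elements of $s$, let $\mathrm{occ}(a,s)$ be the multiplicity of $a$ in $s$, and let $H=\sum_a \frac{\mathrm{occ}(a,s)}{n}\log\frac{n}{\mathrm{occ}(a,s)}$ be the entropy of the distribution of elements in $s$ (the sum is over the distinct elements of $s$). Model. The elements of $s$ arrive one at a time. An online sorting algorithm is a fixed finite program for a comparison-based word RAM with unit-cost operations: while the $i$-th element is being processed, words hold $O(\log i)$ bits, the elements can be accessed only through ternary comparisons (less, equal, greater) between two elements that have already arrived, and all the work for the $i$-th element is finished before the next one is seen. The algorithm does not know $n$, $\sigma$ or $H$ in advance. It sorts online and stably if, for every $s$, it halts on each element and after each element it has the elements seen so far in a linked list, in nondecreasing order, with equal elements in their order of arrival. Each comparison counts as one comparison and takes $O(1)$ time. Theorem. There is a single algorithm that sorts every sequence over every linearly ordered set online and stably and has the following property. When $\sigma=o(n^{1/2}/\log n)$, it uses at most $(H+1)n+o(n)$ ternary comparisons and $O((H+1)n)$ time. That is, there is an absolute constant $C$ such that for every function $f:\mathbb N\to\mathbb R$ with $f(n)=o(n^{1/2}/\log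 n)$ there are a function $g(n)=o(n)$ and an $N$ such that, on every sequence $s$ of length $n$ with $\sigma\le f(n)$, the algorithm uses at most $(H+1)n+g(n)$ ternary comparisons in total and, if $n\ge N$, at most $C(H+1)n$ time in total. -/

import Mathlib

open Filter Asymptotics

universe u

namespace OnlineSort

/-!  A comparison-based word RAM, presented as a small imperative language.  A program is a finite
piece of syntax; it uses finitely many variables and arrays of natural numbers.  The elements to be
sorted are numbered `1, 2, 3, …` in order of arrival, and a program can learn about them only by
the three-way comparison of two elements that have already arrived.  -/

/-- The arithmetic operations; the two tests return `1` or `0`. -/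
inductive Op where
  | add | sub | mul | div | lt | eq

def Op.eval : Op → ℕ → ℕ → ℕ
  | .add, u, v => u + v
  | .sub, u, v => u - v
  | .mul, u, v => u * v
  | .div, u, v => u / v
  | .lt, u, v => if u < v then 1 else 0
  | .eq, u, v => if u = v then 1 else 0

/-- Expressions: constants, variables, array cells `a[e]`, and arithmetic. -/
inductive Expr where
  | const (k : ℕ)
  | var (x : ℕ)
  | get (a : ℕ) (e : Expr)
  | op (o : Op) (e₁ e₂ : Expr)

/-- Programs.
* `assign x e` is `x := e`;
* `put a e₁ e₂` is `a[e₁] := e₂`;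
* `cmp x e₁ e₂` is one ternary comparison of the elements number `e₁` and `e₂`, the outcome
  (`0`, `1`, `2` for less, equal, greater) being written to the variable `x`;
* `branch` and `loop` run their first branch, respectively their body, if the value of the
  expression is not `0`. -/
inductive Prog where
  | skip
  | assign (x : ℕ) (e : Expr)
  | put (a : ℕ) (e₁ e₂ : Expr)
  | cmp (x : ℕ) (e₁ e₂ : Expr)
  | seq (p q : Prog)
  | branch (e : Expr) (p q : Prog)
  | loop (e : Expr) (p : Prog)

/-- The contents of the variables and of the arrays. -/
structure Store where
  var : ℕ → ℕ
  arr : ℕ → ℕ → ℕ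

namespace Store

/-- The initial store: everything is `0`. -/
def init : Store := ⟨fun _ => 0, fun _ _ => 0⟩

def setVar (m : Store) (x v : ℕ) : Store :=
  { m with var := Function.update m.var x v }

def setArr (m : Store) (a p v : ℕ) : Store :=
  { m with arr := Function.update m.arr a (Function.update (m.arr a) p v) }

end Store

namespace Expr

/-- The value of an expression. -/
def val (m : Store) : Expr → ℕ
  | const k => k
  | var x => m.var x
  | get a e => m.arr a (e.val m)
  | op o e₁ e₂ => o.eval (e₁.val m) (e₂.val m)

/-- Every value computed in evaluating the expression, addresses included, is at most `B`. -/
def Fits (B : ℕ) (m : Store) : Expr → Prop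
  | const k => k ≤ B
  | var x => m.var x ≤ B
  | get a e => e.Fits B m ∧ m.arr a (e.val m) ≤ B
  | op o e₁ e₂ => e₁.Fits B m ∧ e₂.Fits B m ∧ o.eval (e₁.val m) (e₂.val m) ≤ B

/-- The number of steps it takes to evaluate an expression. -/
def size : Expr → ℕ
  | const _ => 1
  | var _ => 1
  | get _ e => e.size + 1
  | op _ e₁ e₂ => e₁.size + e₂.size + 1

end Expr

/-- Element number `p` of the sequence `s`, counting from `1`. -/
def elt {α : Type*} (s : List α) : ℕ → Option α
  | 0 => none
  | p + 1 => s[p]?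

/-- The outcome of a ternary comparison. -/
def outcome {α : Type*} [LinearOrder α] (u v : α) : ℕ :=
  if u < v then 0 else if u = v then 1 else 2

/-- `Exec B s p m m' c t`: on a machine whose words hold the numbers `0, …, B`, when the elements
of `s` have arrived, `p` started in the store `m` halts in the store `m'` after `c` ternary
comparisons and `t` steps.  A program that overflows a word, or that compares an element which has
not arrived, gets stuck. -/
inductive Exec {α : Type*} [LinearOrder α] (B : ℕ) (s : List α) :
    Prog → Store → Store → ℕ → ℕ → Prop
  | skip (m : Store) : Exec B s .skip m m 0 1
  | assign (m : Store) (x : ℕ) (e : Expr) (he : e.Fits B m) :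
      Exec B s (.assign x e) m (m.setVar x (e.val m)) 0 (e.size + 1)
  | put (m : Store) (a : ℕ) (e₁ e₂ : Expr) (h₁ : e₁.Fits B m) (h₂ : e₂.Fits B m) :
      Exec B s (.put a e₁ e₂) m (m.setArr a (e₁.val m) (e₂.val m)) 0 (e₁.size + e₂.size + 1)
  | cmp (m : Store) (x : ℕ) (e₁ e₂ : Expr) (h₁ : e₁.Fits B m) (h₂ : e₂.Fits B m) (u v : α)
      (hu : elt s (e₁.val m) = some u) (hv : elt s (e₂.val m) = some v) :
      Exec B s (.cmp x e₁ e₂) m (m.setVar x (outcome u v)) 1 (e₁.size + e₂.size + 1)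
  | seq {p q : Prog} {m₀ m₁ m₂ : Store} {c₁ t₁ c₂ t₂ : ℕ} (h₁ : Exec B s p m₀ m₁ c₁ t₁)
      (h₂ : Exec B s q m₁ m₂ c₂ t₂) : Exec B s (.seq p q) m₀ m₂ (c₁ + c₂) (t₁ + t₂)
  | branch_true {e : Expr} {p q : Prog} {m m' : Store} {c t : ℕ} (he : e.Fits B m)
      (h : e.val m ≠ 0) (hp : Exec B s p m m' c t) :
      Exec B s (.branch e p q) m m' c (e.size + 1 + t)
  | branch_false {e : Expr} {p q : Prog} {m m' : Store} {c t : ℕ} (he : e.Fits B m)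
      (h : e.val m = 0) (hq : Exec B s q m m' c t) :
      Exec B s (.branch e p q) m m' c (e.size + 1 + t)
  | loop_true {e : Expr} {p : Prog} {m₀ m₁ m₂ : Store} {c₁ t₁ c₂ t₂ : ℕ} (he : e.Fits B m₀)
      (h : e.val m₀ ≠ 0) (h₁ : Exec B s p m₀ m₁ c₁ t₁)
      (h₂ : Exec B s (.loop e p) m₁ m₂ c₂ t₂) :
      Exec B s (.loop e p) m₀ m₂ (c₁ + c₂) (e.size + 1 + t₁ + t₂)
  | loop_false {e : Expr} {p : Prog} {m : Store} (he : e.Fits B m) (h : e.val m = 0) :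
      Exec B s (.loop e p) m m 0 (e.size + 1)

/-- `Run b p s m c t`: the online algorithm `p`, fed with the sequence `s`, ends in the store `m`
after `c` ternary comparisons and `t` steps in total.  When element number `i` arrives, `i` is
written to variable `0` and `p` is run to its end, with words that hold the numbers up to
`(i + 1) ^ b` (thus of `O(log i)` bits), before the next element is seen. -/
inductive Run {α : Type*} [LinearOrder α] (b : ℕ) (p : Prog) :
    List α → Store → ℕ → ℕ → Prop
  | nil : Run b p [] Store.init 0 0
  | snoc {s : List α} {m m' : Store} {c t c' t' : ℕ} (x : α) (h : Run b p s m c t)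
      (hx : Exec ((s.length + 1 + 1) ^ b) (s ++ [x]) p (m.setVar 0 (s.length + 1)) m' c' t') :
      Run b p (s ++ [x]) m' (c + c') (t + t')

/-- `l` lists the numbers `1, …, n` of the elements of `s` so that the elements are in
nondecreasing order and equal elements are in their order of arrival. -/
def IsStableSort {α : Type*} [LinearOrder α] (s : List α) (l : List ℕ) : Prop :=
  l.Perm (List.range' 1 s.length) ∧
  l.Pairwise fun p q =>
    ∃ u v, elt s p = some u ∧ elt s q = some v ∧ (u < v ∨ (u = v ∧ p < q))

/-- Array `0` holds the numbers in `l` as a linked list: cell `0` holds the first entry, the cell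
of each entry holds the next entry, and the cell of the last entry holds the end mark `0`. -/
def Store.HoldsList (m : Store) (l : List ℕ) : Prop :=
  List.IsChain (fun p q => m.arr 0 p = q) (0 :: l ++ [0])

/-- The online algorithm `p` sorts stably: on every sequence (hence after each element of a
sequence) it halts and has the elements seen so far in stably sorted order. -/
def SortsStably (b : ℕ) (p : Prog) : Prop :=
  ∀ (α : Type u) [LinearOrder α] (s : List α),
    (∃ m c t, Run b p s m c t) ∧
    ∀ m c t, Run b p s m c t → ∃ l, IsStableSort s l ∧ m.HoldsList l

/-- The number of distinct elements of `s`. -/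
def distinct {α : Type*} [DecidableEq α] (s : List α) : ℕ := s.toFinset.card

/-- The entropy `H` of the distribution of elements in `s`, in bits. -/
noncomputable def entropy {α : Type*} [DecidableEq α] (s : List α) : ℝ :=
  ∑ a ∈ s.toFinset,
    (s.count a : ℝ) / s.length * Real.logb 2 ((s.length : ℝ) / s.count a)

end OnlineSort

namespace OnlineSort

variable {α : Type u} [LinearOrder α]

/-! Equal elements form a class, named by the number of its first element. The algorithm keeps all
elements in a linked list in stably sorted order, with the last element and the size of each class.
With `i` elements in `σ` classes, put `S = σ * i.size`. A table is divided into consecutive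
intervals in the order of the keys, a class of `k` elements receiving `⌊k * S / i⌋ + 1` cells, so
that there are at most `S + σ` cells.

A new element is located by bisecting the table by cells, not by keys. It is compared with the key
that owns the middle cell, and a miss discards that key's whole interval with everything on one side
of it, so at most half of the cells remain. A class of width `w` is therefore found by `c`
comparisons with `2 ^ c * w ≤ 2 * (S + σ)`, which gives `c ≤ 1 + log (i / k) + log (1 + 1 /
i.size)`. These are `searchLoop_does` and `Found.cost`.

The table is rebuilt when a new value appears, or when about `S` elements have arrived since it was
made. A rebuild takes `O(S)` time, as it walks from class to class. It is paid for by the elements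
that arrived meanwhile or, for a new value, directly: there are only `σ` such rebuilds. In between,
the multiplicities seen by the table lag by at most `S`.

The costs are summed by a potential, `comparisonBound`. With `phi n = n log n`, the entropy
satisfies `H n = phi n - ∑ phi (occ a)`, and discrete derivatives of `phi` replace Stirling's
formula. The errors are the sum of the `4 / i.size`, which is `o(n)` by Cesàro means, the lag, at
most `(L + 1) log n` per class with `L = σ * n.size`, and at most `4 * L` comparisons for each new
value. The last two are `O(σ² log² n)`, apart from a term `σ log n`, and this is where `σ = o(√n /
log n)` enters. -/

/-! ### Determinism of the machine and rules for total correctness. -/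

theorem Exec.deterministic {B : ℕ} {s : List α} {p : Prog} {m m₁ m₂ : Store} {c₁ t₁ c₂ t₂ : ℕ}
    (h₁ : Exec B s p m m₁ c₁ t₁) (h₂ : Exec B s p m m₂ c₂ t₂) :
    m₁ = m₂ ∧ c₁ = c₂ ∧ t₁ = t₂ := by
  induction h₁ generalizing m₂ c₂ t₂ with
  | skip => cases h₂; simp
  | assign => cases h₂; simp
  | put => cases h₂; simp
  | cmp m x e₁ e₂ _ _ u v hu hv =>
    cases h₂ with
    | cmp _ _ _ _ _ _ u' v' hu' hv' =>
      rw [hu] at hu'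
      rw [hv] at hv'
      cases hu'
      cases hv'
      simp
  | seq _ _ ih₁ ih₂ =>
    cases h₂ with
    | seq ha hb =>
      obtain ⟨rfl, rfl, rfl⟩ := ih₁ ha
      obtain ⟨rfl, rfl, rfl⟩ := ih₂ hb
      simp
  | branch_true _ h _ ih =>
    cases h₂ with
    | branch_true _ _ hp => obtain ⟨rfl, rfl, rfl⟩ := ih hp; simp
    | branch_false _ h' _ => exact absurd h' h
  | branch_false _ h _ ih =>
    cases h₂ with
    | branch_true _ h' _ => exact absurd h h'
    | branch_false _ _ hp => obtain ⟨rfl, rfl, rfl⟩ := ih hp; simp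
  | loop_true _ h _ _ ih₁ ih₂ =>
    cases h₂ with
    | loop_true _ _ ha hb =>
      obtain ⟨rfl, rfl, rfl⟩ := ih₁ ha
      obtain ⟨rfl, rfl, rfl⟩ := ih₂ hb
      simp
    | loop_false _ h' => exact absurd h' h
  | loop_false _ h =>
    cases h₂ with
    | loop_true _ h' _ _ => exact absurd h h'
    | loop_false => simp

/-- Since the theorem speaks of every run, this reduces it to the construction of one run with the
desired properties. -/
theorem Run.deterministic {b : ℕ} {p : Prog} {s : List α} {m₁ m₂ : Store} {c₁ t₁ c₂ t₂ : ℕ}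
    (h₁ : Run b p s m₁ c₁ t₁) (h₂ : Run b p s m₂ c₂ t₂) : m₁ = m₂ ∧ c₁ = c₂ ∧ t₁ = t₂ := by
  induction h₁ generalizing m₂ c₂ t₂ with
  | nil =>
    generalize hs : ([] : List α) = s' at h₂
    cases h₂ with
    | nil => simp
    | snoc x h hx => simp at hs
  | @snoc s m m' c t c' t' x h hx ih =>
    generalize hs : s ++ [x] = s' at h₂
    cases h₂ with
    | nil => simp at hs
    | @snoc s₂ n n' d v d' v' y k ky =>
      obtain ⟨rfl, hxy⟩ := List.append_inj' hs rfl
      cases hxy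
      obtain ⟨rfl, rfl, rfl⟩ := ih k
      obtain ⟨rfl, rfl, rfl⟩ := hx.deterministic ky
      simp

/-- The program halts when started in `m`, in a store and at a cost that satisfy `Q`. -/
def Does (B : ℕ) (s : List α) (p : Prog) (m : Store) (Q : Store → ℕ → ℕ → Prop) : Prop :=
  ∃ m' c t, Exec B s p m m' c t ∧ Q m' c t

namespace Does

variable {B : ℕ} {s : List α} {m : Store} {Q : Store → ℕ → ℕ → Prop}

theorem mono {p : Prog} {Q' : Store → ℕ → ℕ → Prop} (h : Does B s p m Q)
    (hQ : ∀ m' c t, Q m' c t → Q' m' c t) : Does B s p m Q' := by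
  obtain ⟨m', c, t, he, h⟩ := h
  exact ⟨m', c, t, he, hQ _ _ _ h⟩

theorem skip (h : Q m 0 1) : Does B s .skip m Q := ⟨_, _, _, .skip m, h⟩

theorem assign {x : ℕ} {e : Expr} (he : e.Fits B m) (h : Q (m.setVar x (e.val m)) 0 (e.size + 1)) :
    Does B s (.assign x e) m Q := ⟨_, _, _, .assign m x e he, h⟩

theorem put {a : ℕ} {e₁ e₂ : Expr} (h₁ : e₁.Fits B m) (h₂ : e₂.Fits B m)
    (h : Q (m.setArr a (e₁.val m) (e₂.val m)) 0 (e₁.size + e₂.size + 1)) :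
    Does B s (.put a e₁ e₂) m Q := ⟨_, _, _, .put m a e₁ e₂ h₁ h₂, h⟩

theorem cmp {x : ℕ} {e₁ e₂ : Expr} {u v : α} (h₁ : e₁.Fits B m) (h₂ : e₂.Fits B m)
    (hu : elt s (e₁.val m) = some u) (hv : elt s (e₂.val m) = some v)
    (h : Q (m.setVar x (outcome u v)) 1 (e₁.size + e₂.size + 1)) :
    Does B s (.cmp x e₁ e₂) m Q := ⟨_, _, _, .cmp m x e₁ e₂ h₁ h₂ u v hu hv, h⟩

theorem seq {p q : Prog} (h : Does B s p m fun m₁ c₁ t₁ =>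
      Does B s q m₁ fun m₂ c₂ t₂ => Q m₂ (c₁ + c₂) (t₁ + t₂)) :
    Does B s (.seq p q) m Q := by
  obtain ⟨m₁, c₁, t₁, h₁, m₂, c₂, t₂, h₂, h⟩ := h
  exact ⟨_, _, _, .seq h₁ h₂, h⟩

theorem branch {e : Expr} {p q : Prog} (he : e.Fits B m)
    (hp : e.val m ≠ 0 → Does B s p m fun m' c t => Q m' c (e.size + 1 + t))
    (hq : e.val m = 0 → Does B s q m fun m' c t => Q m' c (e.size + 1 + t)) :
    Does B s (.branch e p q) m Q := by
  by_cases h : e.val m = 0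
  · obtain ⟨m', c, t, hx, h'⟩ := hq h
    exact ⟨_, _, _, .branch_false he h hx, h'⟩
  · obtain ⟨m', c, t, hx, h'⟩ := hp h
    exact ⟨_, _, _, .branch_true he h hx, h'⟩

theorem loop_true {e : Expr} {p : Prog} (he : e.Fits B m) (h0 : e.val m ≠ 0)
    (h : Does B s p m fun m₁ c₁ t₁ =>
      Does B s (.loop e p) m₁ fun m₂ c₂ t₂ => Q m₂ (c₁ + c₂) (e.size + 1 + t₁ + t₂)) :
    Does B s (.loop e p) m Q := by
  obtain ⟨m₁, c₁, t₁, h₁, m₂, c₂, t₂, h₂, h⟩ := h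
  exact ⟨_, _, _, .loop_true he h0 h₁ h₂, h⟩

theorem loop_false {e : Expr} {p : Prog} (he : e.Fits B m) (h0 : e.val m = 0)
    (h : Q m 0 (e.size + 1)) : Does B s (.loop e p) m Q :=
  ⟨_, _, _, .loop_false he h0, h⟩

end Does

namespace Store

@[simp] theorem setVar_var (m : Store) (x v y : ℕ) :
    (m.setVar x v).var y = if y = x then v else m.var y := by
  simp [setVar, Function.update_apply]

@[simp] theorem setVar_arr (m : Store) (x v : ℕ) : (m.setVar x v).arr = m.arr := rfl

@[simp] theorem setArr_var (m : Store) (a p v : ℕ) : (m.setArr a p v).var = m.var := rfl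

@[simp] theorem setArr_arr (m : Store) (a p v b : ℕ) :
    (m.setArr a p v).arr b = if b = a then Function.update (m.arr a) p v else m.arr b := by
  simp only [setArr, Function.update_apply]

end Store

/-! ### Tables divided into intervals of cells. -/

variable {β : Type u}

/-- `Table T st en ρ lo K hi`: the cells `lo, …, hi - 1` of `T` are divided into consecutive
nonempty intervals, one for every key `a` in `K`.  The interval of `a` extends from `st (ρ a)` to
`en (ρ a) - 1` and its cells hold `ρ a`. -/
def Table (T st en : ℕ → ℕ) (ρ : β → ℕ) : ℕ → List β → ℕ → Prop
  | lo, [], hi => lo = hi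
  | lo, a :: K, hi => st (ρ a) = lo ∧ lo < en (ρ a) ∧
      (∀ x, lo ≤ x → x < en (ρ a) → T x = ρ a) ∧ Table T st en ρ (en (ρ a)) K hi

namespace Table

variable {T st en : ℕ → ℕ} {ρ : β → ℕ}

theorem le {K : List β} {lo hi : ℕ} (h : Table T st en ρ lo K hi) : lo ≤ hi := by
  induction K generalizing lo with
  | nil => exact Nat.le_of_eq h
  | cons a K ih => exact (h.2.1.le).trans (ih h.2.2.2)

theorem bounds {K : List β} {lo hi : ℕ} (h : Table T st en ρ lo K hi) {a : β} (ha : a ∈ K) :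
    lo ≤ st (ρ a) ∧ st (ρ a) < en (ρ a) ∧ en (ρ a) ≤ hi := by
  induction K generalizing lo with
  | nil => simp at ha
  | cons b K ih =>
    obtain ⟨h1, h2, -, h4⟩ := h
    rcases List.mem_cons.1 ha with rfl | ha
    · exact ⟨h1.ge, h1 ▸ h2, h4.le⟩
    · have := ih h4 ha
      omega

theorem split {K : List β} {lo hi x : ℕ} (h : Table T st en ρ lo K hi) (h1 : lo ≤ x) (h2 : x < hi) :
    ∃ K₁ a K₂, K = K₁ ++ a :: K₂ ∧ Table T st en ρ lo K₁ (st (ρ a)) ∧ st (ρ a) ≤ x ∧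
      x < en (ρ a) ∧ Table T st en ρ (en (ρ a)) K₂ hi ∧ T x = ρ a := by
  induction K generalizing lo with
  | nil => cases h; omega
  | cons b K ih =>
    obtain ⟨g1, g2, g3, g4⟩ := h
    by_cases hx : x < en (ρ b)
    · exact ⟨[], b, K, rfl, g1.symm, by omega, hx, g4, g3 x h1 hx⟩
    · obtain ⟨K₁, a, K₂, rfl, h3, h4⟩ := ih g4 (by omega)
      exact ⟨b :: K₁, a, K₂, rfl, ⟨g1, g2, g3, h3⟩, h4⟩

theorem congr {T' st' en' : ℕ → ℕ} {ρ' : β → ℕ} {K : List β} {lo hi : ℕ}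
    (h : Table T st en ρ lo K hi)
    (hT : ∀ x, lo ≤ x → x < hi → T' x = T x) (hρ : ∀ a ∈ K, ρ' a = ρ a)
    (hst : ∀ a ∈ K, st' (ρ a) = st (ρ a))
    (hen : ∀ a ∈ K, en' (ρ a) = en (ρ a)) : Table T' st' en' ρ' lo K hi := by
  induction K generalizing lo with
  | nil => exact h
  | cons a K ih =>
    obtain ⟨h1, h2, h3, h4⟩ := h
    have e1 := hρ a (by simp)
    have e2 := hst a (by simp)
    have e3 := hen a (by simp)
    have h5 := h4.le
    refine ⟨by rw [e1, e2, h1], by rwa [e1, e3], fun x hx hx' => ?_, ?_⟩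
    · rw [e1, e3] at hx'
      rw [e1, hT x hx (hx'.trans_le h5), h3 x hx hx']
    · rw [e1, e3]
      exact ih h4 (fun x hx hx' => hT x (h2.le.trans hx) hx') (fun b hb => hρ b (by simp [hb]))
        (fun b hb => hst b (by simp [hb])) (fun b hb => hen b (by simp [hb]))

end Table

/-! ### Searching by bisection of the table. -/

/-- One step of the bisection: the key in the middle cell of the current interval is compared with
the new element. -/
def searchBody : Prog :=
  .seq (.assign 4 (.get 3 (.op .div (.op .add (.var 1) (.var 2)) (.const 2))))
  (.seq (.cmp 3 (.var 0) (.var 4))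
  (.branch (.op .eq (.var 3) (.const 0)) (.assign 2 (.get 4 (.var 4)))
  (.seq (.assign 5 (.var 4))
  (.branch (.op .eq (.var 3) (.const 1)) (.seq (.assign 6 (.var 4)) (.assign 2 (.var 1)))
    (.assign 1 (.get 5 (.var 4)))))))

def searchLoop : Prog := .loop (.op .lt (.var 1) (.var 2)) searchBody

/-- Search for the new element: bisection of the whole table. -/
def searchProg : Prog :=
  .seq (.assign 1 (.const 0)) (.seq (.assign 2 (.var 10))
  (.seq (.assign 5 (.const 0)) (.seq (.assign 6 (.const 0)) searchLoop)))

/-- What the search for `x` among the keys `K` achieves when it starts with an interval of `N`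
cells of the table and makes `c` comparisons. -/
def Found (ρ : α → ℕ) (K : List α) (x : α) (N : ℕ) (m : Store) (c : ℕ) : Prop :=
  ∃ A C, (∀ a ∈ A, a < x) ∧ (∀ a ∈ C, x < a) ∧
    ((K = A ++ C ∧ m.var 6 = 0 ∧ m.var 5 = (A.map ρ).getLastD 0 ∧ (c = 0 ∨ 2 ^ c ≤ 2 * N)) ∨
     (K = A ++ x :: C ∧ m.var 6 = ρ x ∧ m.var 5 = ρ x ∧
       2 ^ c * (m.arr 5 (ρ x) - m.arr 4 (ρ x)) ≤ 2 * N))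

/-- One more comparison doubles `2 ^ c`, and the halved interval pays for it. The case `c = 0`
stands apart because a search that starts with no cells makes no comparison. -/
theorem Found.step {ρ : α → ℕ} {K : List α} {x : α} {N N' : ℕ} {m : Store} {c : ℕ}
    (h : Found ρ K x N' m c) (hN : 2 * N' ≤ N) (hN0 : 0 < N) : Found ρ K x N m (1 + c) := by
  obtain ⟨A, C, hA, hC, h⟩ := h
  refine ⟨A, C, hA, hC, ?_⟩
  rcases h with ⟨h1, h2, h3, h4⟩ | ⟨h1, h2, h3, h4⟩
  · refine .inl ⟨h1, h2, h3, .inr ?_⟩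
    rcases h4 with rfl | h4
    · simp; omega
    · rw [pow_add]; omega
  · refine .inr ⟨h1, h2, h3, ?_⟩
    rw [pow_add, mul_assoc]
    omega

/-- `A` and `C` are the keys already known to be smaller and larger than `x`; `M` are the keys whose
intervals make up the current range of cells. Variable 5 holds the representative of the greatest
key known to be smaller, or `0`. It tells where to insert if the search fails. -/
theorem searchLoop_does {B : ℕ} {s : List α} {ρ : α → ℕ} {K : List α} {x : α} (m : Store)
    (hB : 2 ≤ B) (hx : elt s (m.var 0) = some x) (h0 : m.var 0 ≤ B)
    (hK : K.Pairwise (· < ·)) (hρ : ∀ a ∈ K, elt s (ρ a) = some a ∧ ρ a ≤ B)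
    {A M C : List α} (hAMC : K = A ++ M ++ C)
    (hA : ∀ a ∈ A, a < x) (hC : ∀ a ∈ C, x < a)
    (hM : Table (m.arr 3) (m.arr 4) (m.arr 5) ρ (m.var 1) M (m.var 2))
    (hhi : 2 * m.var 2 ≤ B) (h5 : m.var 5 = (A.map ρ).getLastD 0) (h6 : m.var 6 = 0) :
    Does B s searchLoop m fun m' c t => m'.arr = m.arr ∧
      m'.var 0 = m.var 0 ∧ (∀ v, 7 ≤ v → m'.var v = m.var v) ∧ t ≤ 40 * c + 10 ∧
      Found ρ K x (m.var 2 - m.var 1) m' c := by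
  induction hN : m.var 2 - m.var 1 using Nat.strong_induction_on generalizing m A M C with
  | _ N ih =>
  have hle := hM.le
  by_cases hlt : m.var 1 < m.var 2
  -- The middle cell belongs to some key `a`, whose interval separates those of `M₁` and `M₂`.
  · obtain ⟨M₁, a, M₂, rfl, hM₁, ha1, ha2, hM₂, hTa⟩ :=
      hM.split (x := (m.var 1 + m.var 2) / 2) (by omega) (by omega)
    have haK : a ∈ K := by simp [hAMC]
    obtain ⟨hea, haB⟩ := hρ a haK
    have hl1 := hM₁.le
    have hl2 := hM₂.le
    have hK' := hK
    rw [hAMC] at hK'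
    simp only [List.append_assoc, List.cons_append, List.pairwise_append, List.pairwise_cons,
      List.mem_append, List.mem_cons] at hK'
    refine Does.loop_true ?_ ?_ ?_
    · simp [Expr.Fits, Expr.val, Op.eval, hlt]; omega
    · simp [Expr.val, Op.eval, hlt]
    refine Does.seq (Does.assign ?_ ?_)
    · simp [Expr.Fits, Expr.val, Op.eval, hTa]; omega
    refine Does.seq (Does.cmp (u := x) (v := a) ?_ ?_ ?_ ?_ ?_)
    · simpa [Expr.Fits] using h0
    · simpa [Expr.Fits, Expr.val, Op.eval, hTa] using haB
    · simpa [Expr.val] using hx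
    · simpa [Expr.val, Op.eval, hTa] using hea
    refine Does.branch ?_ ?_ ?_
    · simp only [Expr.Fits, Expr.val, Op.eval, Store.setVar_var, if_true, outcome]
      split_ifs <;> omega
    · intro hv
      have hxa : x < a := by
        by_contra hcon
        simp only [Expr.val, Op.eval, Store.setVar_var, if_true, outcome, if_neg hcon] at hv
        split_ifs at hv <;> simp_all
      refine Does.assign ?_ ?_
      · simp [Expr.Fits, Expr.val, Op.eval, hTa]; omega
      simp only [Expr.size, Expr.val, Op.eval, Store.setVar_var, Store.setVar_arr]
      simp only [hTa]
      norm_num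
      refine (ih (m.arr 4 (ρ a) - m.var 1) (by omega) _ ?_ ?_ (A := A) (M := M₁)
        (C := a :: M₂ ++ C) (by simp [hAMC]) hA ?_ ?_ ?_ ?_ ?_ ?_).mono ?_
      · simpa using hx
      · simpa using h0
      · intro b hb
        simp only [List.cons_append, List.mem_cons, List.mem_append] at hb
        rcases hb with rfl | hb | hb
        · exact hxa
        · exact hxa.trans (hK'.2.1.2.1.1 b (.inl hb))
        · exact hC b hb
      · simpa using hM₁
      · simp; omega
      · simpa using h5
      · simpa using h6
      · simp
      · rintro m' c t ⟨g1, g0, g2, g3, g4⟩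
        refine ⟨by simpa using g1, by simpa using g0, fun v hv => ?_, by omega, ?_⟩
        · rw [g2 v hv]
          simp
          split_ifs <;> omega
        -- The interval of `a` contains the midpoint, so what lies to its left has at most half of
        -- the cells.
        · exact g4.step (by omega) (by omega)
    · intro hv
      have hax : a ≤ x := by
        by_contra hcon
        simp [Expr.val, Op.eval, outcome, not_le.1 hcon] at hv
      refine Does.seq (Does.assign ?_ ?_)
      · simpa [Expr.Fits, Expr.val, Op.eval, hTa] using haB
      refine Does.branch ?_ ?_ ?_
      · simp only [Expr.Fits, Expr.val, Op.eval, Store.setVar_var, outcome]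
        norm_num
        split_ifs <;> omega
      · intro hv
        have hxa : x = a := by
          by_contra hcon
          have : a < x := lt_of_le_of_ne hax (Ne.symm hcon)
          simp [Expr.val, Op.eval, outcome, hcon, this.not_gt] at hv
        subst hxa
        refine Does.seq (Does.assign ?_ ?_)
        · simpa [Expr.Fits, Expr.val, Op.eval, hTa] using haB
        refine Does.assign ?_ ?_
        · simp [Expr.Fits, Expr.val, Op.eval, hTa]; omega
        -- A hit moves the right end to the left end, and this stops the loop.
        refine Does.loop_false ?_ ?_ ?_
        · simp [Expr.Fits, Expr.val, Op.eval, hTa]; omega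
        · simp [Expr.val, Op.eval]
        simp only [Expr.size, Expr.val, Op.eval, Store.setVar_var, Store.setVar_arr]
        simp only [hTa]
        norm_num
        refine ⟨fun v hv => ?_, A ++ M₁, M₂ ++ C, ?_, ?_, .inr ⟨by simp [hAMC], by simp, by simp, ?_⟩⟩
        · split_ifs <;> omega
        · intro b hb
          simp only [List.mem_append] at hb
          rcases hb with hb | hb
          · exact hA b hb
          · exact hK'.2.1.2.2 b hb _ (.inl rfl)
        · intro b hb
          simp only [List.mem_append] at hb
          rcases hb with hb | hb
          · exact hK'.2.1.2.1.1 b (.inl hb)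
          · exact hC b hb
        · simp; omega
      · intro hv
        have hxa : a < x := by
          refine lt_of_le_of_ne hax fun hcon => ?_
          simp [Expr.val, Op.eval, outcome, hcon] at hv
        refine Does.assign ?_ ?_
        · simp [Expr.Fits, Expr.val, Op.eval, hTa]; omega
        simp only [Expr.size, Expr.val, Op.eval, Store.setVar_var, Store.setVar_arr]
        simp only [hTa]
        norm_num
        refine (ih (m.var 2 - m.arr 5 (ρ a)) (by omega) _ ?_ ?_ (A := A ++ M₁ ++ [a]) (M := M₂)
          (C := C) (by simp [hAMC]) ?_ hC ?_ ?_ ?_ ?_ ?_).mono ?_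
        · simpa using hx
        · simpa using h0
        · intro b hb
          simp only [List.mem_append, List.mem_singleton] at hb
          rcases hb with (hb | hb) | rfl
          · exact hA b hb
          · exact (hK'.2.1.2.2 b hb _ (.inl rfl)).trans hxa
          · exact hxa
        · simpa using hM₂
        · simp; omega
        · simp
        · simpa using h6
        · simp
        · rintro m' c t ⟨g1, g0, g2, g3, g4⟩
          refine ⟨by simpa using g1, by simpa using g0, fun v hv => ?_, by omega, ?_⟩
          · rw [g2 v hv]
            simp
            split_ifs <;> omega
          · exact g4.step (by omega) (by omega)
  -- The range has no cells and every interval has at least one, so no candidate is left.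
  · obtain rfl : M = [] := by
      cases M with
      | nil => rfl
      | cons a M => have := hM.bounds (a := a) (by simp); omega
    refine Does.loop_false ?_ ?_
      ⟨rfl, rfl, fun _ _ => rfl, ?_, A, C, hA, hC, .inl ⟨?_, h6, h5, .inl rfl⟩⟩
    · simp [Expr.Fits, Op.eval, Expr.val, hlt]; omega
    · simp [Op.eval, Expr.val, hlt]
    · simp [Expr.size]
    · simpa using hAMC

theorem searchProg_does {B : ℕ} {s : List α} {ρ : α → ℕ} {K : List α} {x : α} (m : Store)
    (hB : 2 ≤ B) (hx : elt s (m.var 0) = some x) (h0 : m.var 0 ≤ B)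
    (hK : K.Pairwise (· < ·)) (hρ : ∀ a ∈ K, elt s (ρ a) = some a ∧ ρ a ≤ B)
    (hT : Table (m.arr 3) (m.arr 4) (m.arr 5) ρ 0 K (m.var 10)) (hW : 2 * m.var 10 ≤ B) :
    Does B s searchProg m fun m' c t => m'.arr = m.arr ∧ m'.var 0 = m.var 0 ∧
      (∀ v, 7 ≤ v → m'.var v = m.var v) ∧ t ≤ 40 * c + 20 ∧ Found ρ K x (m.var 10) m' c := by
  refine Does.seq (Does.assign (by simp [Expr.Fits]) ?_)
  refine Does.seq (Does.assign (by simp [Expr.Fits]; omega) ?_)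
  refine Does.seq (Does.assign (by simp [Expr.Fits]) ?_)
  refine Does.seq (Does.assign (by simp [Expr.Fits]) ?_)
  refine (searchLoop_does (ρ := ρ) (K := K) (x := x) _ hB (by simpa using hx) (by simpa using h0)
    hK hρ (A := []) (M := K) (C := []) (by simp) (by simp) (by simp) (by simpa [Expr.val] using hT)
    (by simpa [Expr.val] using hW) (by simp [Expr.val]) (by simp [Expr.val])).mono ?_
  rintro m' c t ⟨g1, g0, g2, g3, g4⟩
  refine ⟨by simpa using g1, by simpa using g0, fun v hv => ?_, ?_, ?_⟩
  · rw [g2 v hv]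
    simp
    split_ifs <;> omega
  · simp only [Expr.size]
    omega
  · simpa [Expr.val] using g4

/-! ### Rebuilding the table. -/

def fillLoop : Prog :=
  .loop (.op .lt (.var 10) (.var 13))
    (.seq (.put 3 (.var 10) (.var 4)) (.assign 10 (.op .add (.var 10) (.const 1))))

theorem fillLoop_does {B : ℕ} {s : List α} (m : Store) (hB : 1 ≤ B) (h4 : m.var 4 ≤ B)
    (h13 : m.var 13 ≤ B) (hle : m.var 10 ≤ m.var 13) :
    Does B s fillLoop m fun m' c t => c = 0 ∧ t ≤ 20 * (m.var 13 - m.var 10) + 5 ∧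
      m'.var 10 = m.var 13 ∧ (∀ v, v ≠ 10 → m'.var v = m.var v) ∧
      (∀ a, a ≠ 3 → m'.arr a = m.arr a) ∧
      (∀ x, m.var 10 ≤ x → x < m.var 13 → m'.arr 3 x = m.var 4) ∧
      (∀ x, x < m.var 10 → m'.arr 3 x = m.arr 3 x) := by
  induction hN : m.var 13 - m.var 10 generalizing m with
  | zero =>
    have hlt : ¬m.var 10 < m.var 13 := by omega
    refine Does.loop_false ?_ ?_ ⟨rfl, ?_, by omega, fun _ _ => rfl, fun _ _ => rfl, ?_,
      fun _ _ => rfl⟩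
    · simp [Expr.Fits, Op.eval, Expr.val, hlt]; omega
    · simp [Op.eval, Expr.val, hlt]
    · simp [Expr.size]
    · intro x hx hx'
      omega
  | succ N ih =>
    have hlt : m.var 10 < m.var 13 := by omega
    refine Does.loop_true ?_ ?_ ?_
    · simp [Expr.Fits, Op.eval, Expr.val, hlt]; omega
    · simp [Op.eval, Expr.val, hlt]
    have h10 : m.var 10 ≤ B := by omega
    refine Does.seq (Does.put (by simpa [Expr.Fits] using h10) (by simpa [Expr.Fits] using h4) ?_)
    refine Does.assign (by simp [Expr.Fits, Op.eval, Expr.val]; omega) ?_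
    refine (ih _ ?_ ?_ ?_ ?_).mono ?_
    · simpa using h4
    · simpa using h13
    · simp [Op.eval, Expr.val]; omega
    · simp [Op.eval, Expr.val]; omega
    · rintro m' c t ⟨rfl, g2, g3, g4, g5, g6, g7⟩
      simp only [Expr.val, Op.eval, Store.setVar_var, Store.setVar_arr, Store.setArr_var,
        Store.setArr_arr] at g2 g3 g4 g5 g6 g7
      norm_num at g2 g3 g4 g5 g6 g7
      refine ⟨rfl, ?_, g3, fun v hv => ?_, fun a ha => ?_, fun x hx hx' => ?_, fun x hx => ?_⟩
      · simp only [Expr.size]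
        omega
      · rw [g4 v hv, if_neg hv]
      · rw [g5 a ha, if_neg ha]
      · rcases hx.eq_or_lt with rfl | hx
        · rw [g7 _ (by omega)]
          simp
        · exact g6 x (by omega) hx'
      · rw [g7 x (by omega), Function.update_of_ne (by omega)]

/-- The table interval of one class is written, and the class that follows it in the linked list is
found. -/
def rebuildBody : Prog :=
  .seq (.put 4 (.var 4) (.var 10))
  (.seq (.assign 13 (.op .add (.var 10)
    (.op .add (.op .div (.op .mul (.get 2 (.var 4)) (.var 12)) (.var 0)) (.const 1))))
  (.seq (.put 5 (.var 4) (.var 13))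
  (.seq fillLoop (.assign 4 (.get 0 (.get 1 (.var 4)))))))

def rebuildLoop : Prog := .loop (.var 4) rebuildBody

/-- The number of cells that the table gives to a class of `k` among `i` elements. -/
def weight (i S k : ℕ) : ℕ := k * S / i + 1

/-- The list successor of the last element of a class is the first element of the next class
(`hnext`). The walk thus skips the interior of the classes, and the time is proportional to the
cells written and not to the number of elements. -/
theorem rebuildLoop_does {B : ℕ} {s : List α} {ρ : α → ℕ} {cnt : α → ℕ} (K : List α) (m : Store)
    (hρinj : (K.map ρ).Nodup) (hρ : ∀ a ∈ K, ρ a ≠ 0 ∧ ρ a ≤ B)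
    (h2 : ∀ a ∈ K, m.arr 2 (ρ a) = cnt a) (hcnt : ∀ a ∈ K, cnt a ≤ B ∧ cnt a * m.var 12 ≤ B)
    (h1 : ∀ a ∈ K, m.arr 1 (ρ a) ≤ B) (h0 : m.var 0 ≤ B) (h12 : m.var 12 ≤ B)
    (h4 : m.var 4 = (K.map ρ).headD 0)
    (hnext : ∀ A a C, K = A ++ a :: C → m.arr 0 (m.arr 1 (ρ a)) = (C.map ρ).headD 0)
    (hW : m.var 10 + (K.map fun a => weight (m.var 0) (m.var 12) (cnt a)).sum ≤ B) :
    Does B s rebuildLoop m fun m' c t => c = 0 ∧ t ≤ 60 * (m'.var 10 - m.var 10) + 5 ∧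
      m'.var 10 = m.var 10 + (K.map fun a => weight (m.var 0) (m.var 12) (cnt a)).sum ∧
      Table (m'.arr 3) (m'.arr 4) (m'.arr 5) ρ (m.var 10) K (m'.var 10) ∧
      (∀ a ∈ K, m'.arr 5 (ρ a) = m'.arr 4 (ρ a) + weight (m.var 0) (m.var 12) (cnt a)) ∧
      (∀ v, v ≠ 4 → v ≠ 10 → v ≠ 13 → m'.var v = m.var v) ∧
      (∀ a, a ≤ 2 → m'.arr a = m.arr a) ∧
      (∀ x, x < m.var 10 → m'.arr 3 x = m.arr 3 x) ∧
      (∀ r, r ∉ K.map ρ → m'.arr 4 r = m.arr 4 r ∧ m'.arr 5 r = m.arr 5 r) := by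
  induction K generalizing m with
  | nil =>
    simp at h4
    refine Does.loop_false (by simp [Expr.Fits, h4]) (by simp [Expr.val, h4]) ⟨rfl, ?_⟩
    simp [Expr.size, Table]
  | cons a K ih =>
    obtain ⟨ha0, haB⟩ := hρ a (by simp)
    have h4' : m.var 4 = ρ a := by simpa using h4
    simp only [List.map_cons, List.sum_cons] at hW
    have hc := hcnt a (by simp)
    have h2a := h2 a (by simp)
    have h1a := h1 a (by simp)
    have hn := hnext [] a K rfl
    have hinj : ρ a ∉ K.map ρ := (List.nodup_cons.1 hρinj).1
    have hw : weight (m.var 0) (m.var 12) (cnt a) = cnt a * m.var 12 / m.var 0 + 1 := rfl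
    refine Does.loop_true (by simp [Expr.Fits, h4', haB]) (by simp [Expr.val, h4', ha0]) ?_
    refine Does.seq (Does.put (by simp [Expr.Fits, h4', haB]) (by simp [Expr.Fits]; omega) ?_)
    refine Does.seq (Does.assign ?_ ?_)
    · simp [Expr.Fits, Expr.val, Op.eval, h4', h2a]
      omega
    simp only [Expr.val, Op.eval, Store.setArr_arr, Store.setArr_var, h4']
    norm_num
    rw [h2a, ← hw]
    clear hw
    have hw1 : 0 < weight (m.var 0) (m.var 12) (cnt a) := Nat.succ_pos _
    refine Does.seq (Does.put (by simp [Expr.Fits, h4', haB]) (by simp [Expr.Fits]; omega) ?_)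
    refine Does.seq ((fillLoop_does _ (by omega) ?_ ?_ ?_).mono ?_)
    · simpa [h4'] using haB
    · simp; omega
    · simp
    rintro m₁ c₁ t₁ ⟨rfl, g2, g3, g4, g5, g6, g7⟩
    simp only [Expr.val, Store.setVar_var, Store.setVar_arr, Store.setArr_var,
        Store.setArr_arr] at g2 g3 g4 g5 g6 g7
    norm_num [h4'] at g2 g3 g4 g5 g6 g7
    have e4 : m₁.var 4 = ρ a := by simp [g4, h4']
    have e0 : m₁.var 0 = m.var 0 := by simp [g4]
    have e12 : m₁.var 12 = m.var 12 := by simp [g4]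
    have a0 : m₁.arr 0 = m.arr 0 := by simp [g5]
    have a1 : m₁.arr 1 = m.arr 1 := by simp [g5]
    have a2 : m₁.arr 2 = m.arr 2 := by simp [g5]
    have a4 : m₁.arr 4 = Function.update (m.arr 4) (ρ a) (m.var 10) := by simp [g5]
    have a5 : m₁.arr 5 = Function.update (m.arr 5) (ρ a)
      (m.var 10 + weight (m.var 0) (m.var 12) (cnt a)) := by simp [g5]
    refine Does.assign ?_ ?_
    · simp [Expr.Fits, Expr.val, e4, a1, a0, hn, haB, h1a]
      cases K with
      | nil => simp
      | cons b K => simpa using (hρ b (by simp)).2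
    simp only [Expr.val, e4, a1, a0, hn]
    refine (ih _ (List.nodup_cons.1 hρinj).2 (fun b hb => hρ b (by simp [hb])) (fun b hb => ?_)
      (fun b hb => ?_) (fun b hb => ?_) ?_ ?_ ?_ (fun A b C hK => ?_) ?_).mono ?_
    · simpa [a2] using h2 b (by simp [hb])
    · simpa [e12] using hcnt b (by simp [hb])
    · simpa [a1] using h1 b (by simp [hb])
    · simpa [e0] using h0
    · simpa [e12] using h12
    · simp
    · simpa [a0, a1] using hnext (a :: A) b C (by simp [hK])
    · simp [e0, e12, g3]
      omega
    rintro m₂ c₂ t₂ ⟨rfl, k2, k3, k4, k5, k6, k7, k8, k9⟩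
    simp only [Store.setVar_var, Store.setVar_arr] at k2 k3 k4 k5 k6 k7 k8 k9
    norm_num [g3, e0, e12] at k2 k3 k4 k5 k6 k7 k8 k9
    have k4le := k4.le
    have z4 : m₂.arr 4 (ρ a) = m.var 10 := by rw [(k9 _ (by simpa using hinj)).1, a4]; simp
    have z5 : m₂.arr 5 (ρ a) = m.var 10 + weight (m.var 0) (m.var 12) (cnt a) := by
      rw [(k9 _ (by simpa using hinj)).2, a5]; simp
    refine ⟨by simp, ?_, ?_, ⟨z4, by omega, fun x hx hx' => ?_, ?_⟩, ?_, fun v hv hv' hv'' => ?_,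
      fun b hb => ?_, fun x hx => ?_, fun r hr1 hr2 => ?_⟩
    · simp only [Expr.size]
      omega
    · omega
    · rw [z5] at hx'
      rw [k8 x hx', g6 x hx hx']
    · rw [z5]
      exact k4
    · exact ⟨by rw [z4, z5], k5⟩
    · rw [k6 v hv hv' hv'', if_neg hv, g4 v hv', if_neg hv'']
    · rw [k7 b hb, g5 b (by omega), if_neg (by omega), if_neg (by omega)]
    · rw [k8 x (by omega), g7 x hx]
    · obtain ⟨q1, q2⟩ := k9 r (by simpa using hr2)
      rw [q1, q2, a4, a5, Function.update_of_ne hr1, Function.update_of_ne hr1]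
      exact ⟨rfl, rfl⟩

/-- The table is made anew from the linked list and the multiplicities. -/
def rebuildProg : Prog :=
  .seq (.assign 12 (.op .mul (.var 7) (.var 8)))
  (.seq (.assign 4 (.get 0 (.const 0)))
  (.seq (.assign 10 (.const 0))
  (.seq rebuildLoop (.assign 11 (.op .add (.var 0) (.var 12))))))

theorem rebuildProg_does {B : ℕ} {s : List α} {ρ : α → ℕ} {cnt : α → ℕ} (K : List α) (m : Store)
    {S : ℕ} (hS : m.var 7 * m.var 8 = S) (h7 : m.var 7 ≤ B) (h8 : m.var 8 ≤ B)
    (hρinj : (K.map ρ).Nodup) (hρ : ∀ a ∈ K, ρ a ≠ 0 ∧ ρ a ≤ B)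
    (h2 : ∀ a ∈ K, m.arr 2 (ρ a) = cnt a) (hcnt : ∀ a ∈ K, cnt a ≤ B ∧ cnt a * S ≤ B)
    (h1 : ∀ a ∈ K, m.arr 1 (ρ a) ≤ B) (h0 : m.var 0 + S ≤ B)
    (h4 : m.arr 0 0 = (K.map ρ).headD 0)
    (hnext : ∀ A a C, K = A ++ a :: C → m.arr 0 (m.arr 1 (ρ a)) = (C.map ρ).headD 0)
    (hW : (K.map fun a => weight (m.var 0) S (cnt a)).sum ≤ B) :
    Does B s rebuildProg m fun m' c t => c = 0 ∧ t ≤ 60 * m'.var 10 + 30 ∧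
      m'.var 10 = (K.map fun a => weight (m.var 0) S (cnt a)).sum ∧
      Table (m'.arr 3) (m'.arr 4) (m'.arr 5) ρ 0 K (m'.var 10) ∧
      (∀ a ∈ K, m'.arr 5 (ρ a) = m'.arr 4 (ρ a) + weight (m.var 0) S (cnt a)) ∧
      (∀ v, 7 ≤ v → v ≤ 9 → m'.var v = m.var v) ∧
      (∀ a, a ≤ 2 → m'.arr a = m.arr a) ∧ m'.var 11 = m.var 0 + S := by
  refine Does.seq (Does.assign ?_ ?_)
  · simp [Expr.Fits, Expr.val, Op.eval]
    omega
  refine Does.seq (Does.assign ?_ ?_)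
  · simp [Expr.Fits, Expr.val, h4]
    cases K with
    | nil => simp
    | cons b K => simpa using (hρ b (by simp)).2
  refine Does.seq (Does.assign (by simp [Expr.Fits]) ?_)
  refine Does.seq
    ((rebuildLoop_does (ρ := ρ) (cnt := cnt) K _ hρinj hρ ?_ ?_ ?_ ?_ ?_ ?_ ?_ ?_).mono ?_)
  · simpa using h2
  · simpa [Expr.val, Op.eval, hS] using hcnt
  · simpa using h1
  · simp; omega
  · simp [Expr.val, Op.eval, hS]; omega
  · simpa [Expr.val] using h4
  · simpa using hnext
  · simpa [Expr.val, Op.eval, hS] using hW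
  rintro m' c t ⟨rfl, g2, g3, g4, g5, g6, g7, -, -⟩
  simp only [Store.setVar_var, Store.setVar_arr, Expr.val, Op.eval] at g2 g3 g4 g5 g6 g7
  norm_num [hS] at g2 g3 g4 g5 g6 g7
  have e0 : m'.var 0 = m.var 0 := by simp [g6]
  have e12 : m'.var 12 = S := by simp [g6]
  refine Does.assign ?_ ⟨rfl, ?_, ?_⟩
  · simp [Expr.Fits, Expr.val, Op.eval, e0, e12]
    omega
  · simp [Expr.size]
    omega
  · simp only [Store.setVar_var, Store.setVar_arr, Expr.val, Op.eval, e0, e12]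
    norm_num
    refine ⟨g3, g4, g5, fun v hv hv' => ?_, g7⟩
    rw [if_neg (by omega), g6 v (by omega) (by omega) (by omega), if_neg (by omega),
      if_neg (by omega), if_neg (by omega)]

/-! ### Occurrences of an element, and the stably sorted order. -/

theorem elt_snoc_of_le {s : List β} {x : β} {p : ℕ} (h : p ≤ s.length) :
    elt (s ++ [x]) p = elt s p := by
  cases p with
  | zero => rfl
  | succ p => simp only [elt]; exact List.getElem?_append_left (by omega)

theorem elt_snoc_last (s : List β) (x : β) : elt (s ++ [x]) (s.length + 1) = some x := by
  simp [elt]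

theorem elt_eq_some_le {s : List β} {p : ℕ} {a : β} (h : elt s p = some a) :
    1 ≤ p ∧ p ≤ s.length := by
  cases p with
  | zero => simp [elt] at h
  | succ p =>
    simp only [elt] at h
    have := (List.getElem?_eq_some_iff.1 h).1
    omega

/-- The numbers of the elements of `s` that are equal to `a`, in order of arrival. -/
def positions (s : List α) (a : α) : List ℕ :=
  (List.range' 1 s.length).filter fun p => elt s p = some a

/-- The first occurrence of `a`, or `0`. -/
def rep (s : List α) (a : α) : ℕ := (positions s a).headD 0

/-- The last occurrence of `a`, or `0`. -/
def lst (s : List α) (a : α) : ℕ := (positions s a).getLastD 0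

theorem mem_positions {s : List α} {a : α} {p : ℕ} : p ∈ positions s a ↔ elt s p = some a := by
  simp only [positions, List.mem_filter, List.mem_range'_1, decide_eq_true_eq]
  refine ⟨fun h => h.2, fun h => ⟨?_, h⟩⟩
  have := elt_eq_some_le h
  omega

theorem positions_snoc (s : List α) (x a : α) :
    positions (s ++ [x]) a = positions s a ++ if x = a then [s.length + 1] else [] := by
  simp only [positions, List.length_append, List.length_singleton]
  rw [List.range'_concat, List.filter_append]
  congr 1
  · refine List.filter_congr fun p hp => ?_
    rw [List.mem_range'_1] at hp
    rw [elt_snoc_of_le (by omega)]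
  · rw [one_mul, add_comm 1 s.length]
    simp only [List.filter_cons, elt_snoc_last, List.filter_nil, Option.some.injEq,
      decide_eq_true_eq]

theorem length_positions (s : List α) (a : α) : (positions s a).length = s.count a := by
  induction s using List.reverseRecOn with
  | nil => rfl
  | append_singleton s x ih =>
    rw [positions_snoc, List.length_append, ih, List.count_append, List.count_singleton]
    by_cases h : x = a <;> simp [h]

theorem positions_eq_nil {s : List α} {a : α} : positions s a = [] ↔ a ∉ s := by
  rw [← List.length_eq_zero_iff, length_positions, List.count_eq_zero]

theorem exists_positions_eq_cons {s : List α} {a : α} (h : a ∈ s) :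
    ∃ P, positions s a = rep s a :: P := by
  cases hp : positions s a with
  | nil => exact absurd h (positions_eq_nil.1 hp)
  | cons p P => exact ⟨P, by simp [rep, hp]⟩

theorem exists_positions_eq_snoc {s : List α} {a : α} (h : a ∈ s) :
    ∃ P, positions s a = P ++ [lst s a] := by
  rcases List.eq_nil_or_concat (positions s a) with hp | ⟨P, p, hp⟩
  · exact absurd h (positions_eq_nil.1 hp)
  · exact ⟨P, by simp [lst, hp]⟩

theorem elt_rep {s : List α} {a : α} (h : a ∈ s) : elt s (rep s a) = some a := by
  obtain ⟨P, hP⟩ := exists_positions_eq_cons h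
  exact mem_positions.1 (by simp [hP])

theorem elt_lst {s : List α} {a : α} (h : a ∈ s) : elt s (lst s a) = some a := by
  obtain ⟨P, hP⟩ := exists_positions_eq_snoc h
  exact mem_positions.1 (by simp [hP])

theorem rep_snoc {s : List α} {a : α} (h : a ∈ s) (x : α) : rep (s ++ [x]) a = rep s a := by
  obtain ⟨P, hP⟩ := exists_positions_eq_cons h
  rw [rep, positions_snoc, hP]
  rfl

theorem rep_snoc_new {s : List α} {x : α} (h : x ∉ s) : rep (s ++ [x]) x = s.length + 1 := by
  rw [rep, positions_snoc, positions_eq_nil.2 h]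
  simp

theorem lst_snoc_self (s : List α) (x : α) : lst (s ++ [x]) x = s.length + 1 := by
  rw [lst, positions_snoc]
  simp

theorem lst_snoc_of_ne (s : List α) {x a : α} (h : a ≠ x) : lst (s ++ [x]) a = lst s a := by
  rw [lst, positions_snoc, if_neg h.symm, List.append_nil, lst]

theorem nodup_positions (s : List α) (a : α) : (positions s a).Nodup :=
  List.Nodup.filter _ List.nodup_range'

theorem pairwise_positions (s : List α) (a : α) : (positions s a).Pairwise (· < ·) :=
  List.Pairwise.filter _ (List.pairwise_lt_range' (s := 1) (n := s.length))

theorem nodup_flatMap_positions (s : List α) {K : List α} (hK : K.Nodup) :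
    (K.flatMap (positions s)).Nodup := by
  rw [List.nodup_flatMap]
  refine ⟨fun a _ => nodup_positions s a, hK.imp fun {a b} hab => ?_⟩
  intro p hp hp'
  rw [mem_positions] at hp hp'
  exact hab (by simpa [hp] using hp')

/-- The stable order is the concatenation of the lists of occurrences, taken in the order of the
keys. -/
theorem isStableSort_flatMap {s K : List α} (hK : K.Pairwise (· < ·)) (hs : ∀ a, a ∈ K ↔ a ∈ s) :
    IsStableSort s (K.flatMap (positions s)) := by
  constructor
  · rw [List.perm_ext_iff_of_nodup (nodup_flatMap_positions s (hK.imp fun h => h.ne))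
      List.nodup_range']
    intro p
    simp only [List.mem_flatMap, mem_positions, List.mem_range'_1]
    constructor
    · rintro ⟨a, -, h⟩
      have := elt_eq_some_le h
      omega
    · rintro ⟨h1, h2⟩
      obtain ⟨q, rfl⟩ : ∃ q, p = q + 1 := ⟨p - 1, by omega⟩
      have hq : q < s.length := by omega
      exact ⟨s[q], (hs _).2 (List.getElem_mem hq), by simp [elt, hq]⟩
  · rw [List.pairwise_flatMap]
    refine ⟨fun a _ => (pairwise_positions s a).imp_of_mem fun {p q} hp hq h => ?_,
      hK.imp fun {a b} hab p hp q hq => ?_⟩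
    · exact ⟨a, a, mem_positions.1 hp, mem_positions.1 hq, .inr ⟨rfl, h⟩⟩
    · exact ⟨a, b, mem_positions.1 hp, mem_positions.1 hq, .inl hab⟩

/-! ### Linked lists and their description by the store. -/

theorem isChain_congr_of_dropLast {f g : ℕ → ℕ} {l : List ℕ} {q : ℕ}
    (h : List.IsChain (fun a b => f a = b) (l ++ [q])) (hfg : ∀ a ∈ l, g a = f a) :
    List.IsChain (fun a b => g a = b) (l ++ [q]) := by
  induction l with
  | nil => simp
  | cons a l ih =>
    cases l with
    | nil => simp_all
    | cons b l =>
      simp only [List.cons_append, List.isChain_cons_cons] at h ih ⊢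
      exact ⟨by rw [hfg a (by simp), h.1], ih h.2 fun c hc => hfg c (by simp_all)⟩

/-- Insertion into a linked list. -/
theorem isChain_insert {f : ℕ → ℕ} {P Q : List ℕ} {q i : ℕ}
    (h : List.IsChain (fun a b => f a = b) (P ++ q :: (Q ++ [0])))
    (hnd : (P ++ q :: Q).Nodup) (hi : i ∉ P ++ q :: Q) :
    List.IsChain (fun a b => Function.update (Function.update f i (f q)) q i a = b)
      (P ++ q :: i :: (Q ++ [0])) := by
  simp only [List.mem_append, List.mem_cons, not_or] at hi
  have hqP : q ∉ P := fun hq => by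
    rw [List.nodup_append] at hnd
    exact hnd.2.2 q hq q (by simp) rfl
  have hqQ : q ∉ Q := (List.nodup_cons.1 (List.nodup_append.1 hnd).2.1).1
  rw [List.isChain_split] at h ⊢
  refine ⟨isChain_congr_of_dropLast h.1 fun a ha => ?_, ?_⟩
  · rw [Function.update_of_ne (by rintro rfl; exact hqP ha),
      Function.update_of_ne (by rintro rfl; exact hi.1 ha)]
  · rw [List.isChain_cons_cons]
    refine ⟨by simp, ?_⟩
    have h2 := h.2
    have key : List.IsChain (fun a b => Function.update (Function.update f i (f q)) q i a = b)
        (Q ++ [0]) := by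
      refine isChain_congr_of_dropLast h2.tail fun a ha => ?_
      rw [Function.update_of_ne (by rintro rfl; exact hqQ ha),
        Function.update_of_ne (by rintro rfl; exact hi.2.2 ha)]
    cases Q with
    | nil =>
      simp only [List.nil_append, List.isChain_cons_cons] at h2 ⊢
      rw [Function.update_of_ne hi.2.1, Function.update_self]
      exact ⟨h2.1, by simp⟩
    | cons b Q =>
      simp only [List.cons_append, List.isChain_cons_cons] at h2 ⊢
      rw [Function.update_of_ne hi.2.1, Function.update_self]
      exact ⟨h2.1, by simpa using key⟩

/-- Sorted lists of the distinct elements. -/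
structure IsKeys (s K : List α) : Prop where
  sorted : K.Pairwise (· < ·)
  mem : ∀ a, a ∈ K ↔ a ∈ s

theorem IsKeys.nodup {s K : List α} (h : IsKeys s K) : K.Nodup := h.sorted.imp fun h => h.ne

theorem IsKeys.toFinset {s K : List α} (h : IsKeys s K) : s.toFinset = K.toFinset := by
  ext a
  simp [h.mem]

theorem IsKeys.length {s K : List α} (h : IsKeys s K) : K.length = distinct s := by
  rw [distinct, h.toFinset, List.toFinset_card_of_nodup h.nodup]

theorem IsKeys.sum_count {s K : List α} (h : IsKeys s K) :
    (K.map fun a => s.count a).sum = s.length := by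
  rw [← List.sum_toFinset _ h.nodup, ← h.toFinset]
  simp

theorem IsKeys.nodup_reps {s K : List α} (h : IsKeys s K) : (K.map (rep s)).Nodup := by
  refine h.nodup.map_on fun a ha b hb hab => ?_
  have h1 := elt_rep ((h.mem a).1 ha)
  rw [hab, elt_rep ((h.mem b).1 hb)] at h1
  exact (Option.some.inj h1).symm

/-- The rounded-down shares add up to at most `S`, and each class has one extra cell. -/
theorem IsKeys.sum_weight {s K : List α} (h : IsKeys s K) (S : ℕ) :
    (K.map fun a => weight s.length S (s.count a)).sum ≤ S + K.length := by
  rcases Nat.eq_zero_or_pos s.length with h0 | h0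
  · simp [weight, h0]
  have h1 : (K.map fun a => weight s.length S (s.count a)).sum =
      (K.map fun a => s.count a * S / s.length).sum + K.length := by
    simp [weight, List.sum_map_add]
  have h2 : s.length * (K.map fun a => s.count a * S / s.length).sum ≤ s.length * S := by
    calc s.length * (K.map fun a => s.count a * S / s.length).sum
        = (K.map fun a => s.length * (s.count a * S / s.length)).sum := by
          rw [List.sum_map_mul_left]
      _ ≤ (K.map fun a => s.count a * S).sum :=
          List.sum_le_sum fun a _ => Nat.mul_div_le _ _
      _ = s.length * S := by rw [List.sum_map_mul_right, h.sum_count]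
  have := Nat.le_of_mul_le_mul_left h2 h0
  omega

/-- The part of the store that describes the sorted list. -/
structure Listed (s K : List α) (m : Store) : Prop extends IsKeys s K where
  chain : m.HoldsList (K.flatMap (positions s))
  last_zero : m.arr 1 0 = 0
  last : ∀ a ∈ K, m.arr 1 (rep s a) = lst s a
  cnt : ∀ a ∈ K, m.arr 2 (rep s a) = s.count a
  card : m.var 7 = K.length

theorem Listed.arr_zero {s K : List α} {m : Store} (h : Listed s K m) :
    m.arr 0 0 = (K.map (rep s)).headD 0 := by
  have := h.chain
  cases K with
  | nil => simpa [Store.HoldsList] using this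
  | cons a K =>
    obtain ⟨P, hP⟩ := exists_positions_eq_cons ((h.mem a).1 (by simp))
    simp only [Store.HoldsList, List.flatMap_cons, hP, List.cons_append,
      List.isChain_cons_cons] at this
    exact this.1

theorem Listed.next {s K : List α} {m : Store} (h : Listed s K m) (A : List α) (a : α) (C : List α)
    (hK : K = A ++ a :: C) : m.arr 0 (m.arr 1 (rep s a)) = (C.map (rep s)).headD 0 := by
  have hc := h.chain
  have haK : a ∈ K := by simp [hK]
  rw [h.last a haK]
  obtain ⟨P, hP⟩ := exists_positions_eq_snoc ((h.mem a).1 haK)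
  have e : 0 :: K.flatMap (positions s) ++ [0] =
      (0 :: A.flatMap (positions s) ++ P) ++ lst s a :: (C.flatMap (positions s) ++ [0]) := by
    simp [hK, hP]
  rw [Store.HoldsList, e, List.isChain_split] at hc
  have hc := hc.2
  cases C with
  | nil => simpa using hc
  | cons b C =>
    obtain ⟨R, hR⟩ := exists_positions_eq_cons ((h.mem b).1 (by simp [hK]))
    simp only [List.flatMap_cons, hR, List.cons_append, List.isChain_cons_cons] at hc
    exact hc.1

/-! ### Inserting the new element. -/

/-- Insertion of the new element into the linked list after the element that the search found. -/
def insertProg : Prog :=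
  .seq (.assign 14 (.get 1 (.var 5)))
  (.seq (.put 0 (.var 0) (.get 0 (.var 14)))
  (.seq (.put 0 (.var 14) (.var 0))
  (.seq (.branch (.var 6) .skip
    (.seq (.assign 6 (.var 0)) (.seq (.put 2 (.var 0) (.const 0))
      (.seq (.assign 7 (.op .add (.var 7) (.const 1))) (.assign 11 (.const 0))))))
  (.seq (.put 1 (.var 6) (.var 0)) (.put 2 (.var 6) (.op .add (.get 2 (.var 6)) (.const 1)))))))

theorem insertProg_does {B : ℕ} {s : List α} (m : Store) {q : ℕ} (hq : m.arr 1 (m.var 5) = q)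
    (hqB : q ≤ B) (h0 : m.var 0 ≤ B) (h5 : m.var 5 ≤ B) (h6 : m.var 6 ≤ B) (hf : m.arr 0 q ≤ B)
    (h2 : m.var 6 ≠ 0 → m.arr 2 (m.var 6) + 1 ≤ B) (h7 : m.var 7 + 1 ≤ B) :
    Does B s insertProg m fun m' c t => c = 0 ∧ t ≤ 60 ∧
      m'.arr 0 = Function.update (Function.update (m.arr 0) (m.var 0) (m.arr 0 q)) q (m.var 0) ∧
      m'.arr 1 = Function.update (m.arr 1) (if m.var 6 = 0 then m.var 0 else m.var 6) (m.var 0) ∧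
      (∀ p, m'.arr 2 p = if p = (if m.var 6 = 0 then m.var 0 else m.var 6) then
        (if m.var 6 = 0 then 0 else m.arr 2 p) + 1 else m.arr 2 p) ∧
      m'.var 7 = m.var 7 + (if m.var 6 = 0 then 1 else 0) ∧
      m'.var 11 = (if m.var 6 = 0 then 0 else m.var 11) ∧
      (∀ a, 3 ≤ a → m'.arr a = m.arr a) ∧
      (∀ v, v = 0 ∨ (8 ≤ v ∧ v ≤ 10) → m'.var v = m.var v) := by
  refine Does.seq (Does.assign (by simp [Expr.Fits, Expr.val, hq, hqB, h5]) ?_)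
  refine Does.seq (Does.put (by simp [Expr.Fits, h0]) (by simp [Expr.Fits, Expr.val, hq, hqB, hf]) ?_)
  refine Does.seq (Does.put (by simp [Expr.Fits, Expr.val, hq, hqB]) (by simp [Expr.Fits, h0]) ?_)
  refine Does.seq (Does.branch (by simp [Expr.Fits, h6]) (fun hv => ?_) (fun hv => ?_))
  · have hv6 : m.var 6 ≠ 0 := by simpa [Expr.val] using hv
    have h2 := h2 hv6
    refine Does.skip ?_
    refine Does.seq (Does.put (by simp [Expr.Fits, h6]) (by simp [Expr.Fits, h0]) ?_)
    refine Does.put (by simp [Expr.Fits, h6]) (by simp [Expr.Fits, Expr.val, Op.eval]; omega) ?_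
    refine ⟨rfl, by simp [Expr.size], ?_, ?_, fun p => ?_, ?_, ?_, fun a ha => ?_, fun v hv => ?_⟩
    · simp [Expr.val, hq]
    · simp [Expr.val, hv6]
    · simp [Expr.val, hv6, Function.update_apply, Op.eval]
      split_ifs with hp
      · rw [hp]
      · rfl
    · simp [hv6]
    · simp [hv6]
    · simp
      split_ifs <;> first | omega | rfl
    · simp
      intro h14
      omega
  · have hv6 : m.var 6 = 0 := by simpa [Expr.val] using hv
    refine Does.seq (Does.assign (by simp [Expr.Fits, h0]) ?_)
    refine Does.seq (Does.put (by simp [Expr.Fits, h0]) (by simp [Expr.Fits]) ?_)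
    refine Does.seq (Does.assign (by simp [Expr.Fits, Expr.val, Op.eval]; omega) ?_)
    refine Does.assign (by simp [Expr.Fits]) ?_
    refine Does.seq (Does.put (by simp [Expr.Fits, Expr.val, h0]) (by simp [Expr.Fits, h0]) ?_)
    refine Does.put (by simp [Expr.Fits, Expr.val, h0]) ?_ ?_
    · simp [Expr.Fits, Expr.val, Op.eval, h0]
      omega
    refine ⟨rfl, by simp [Expr.size], ?_, ?_, fun p => ?_, ?_, ?_, fun a ha => ?_, fun v hv => ?_⟩
    · simp [Expr.val, hq]
    · simp [Expr.val, hv6]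
    · simp [Expr.val, hv6, Function.update_apply, Op.eval]
      split_ifs <;> rfl
    · simp [hv6, Expr.val, Op.eval]
    · simp [hv6, Expr.val]
    · simp
      split_ifs <;> first | omega | rfl
    · simp
      split_ifs <;> omega

theorem Op.eval_lt_le (u v : ℕ) : Op.lt.eval u v ≤ 1 := by
  simp only [Op.eval]
  split_ifs <;> omega

theorem Listed.congr {s K : List α} {m m' : Store} (h : Listed s K m)
    (h0 : ∀ a, a ≤ 2 → m'.arr a = m.arr a) (h7 : m'.var 7 = m.var 7) : Listed s K m' where
  sorted := h.sorted
  mem := h.mem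
  chain := by rw [Store.HoldsList, h0 0 (by omega)]; exact h.chain
  last_zero := by rw [h0 1 (by omega)]; exact h.last_zero
  last := by rw [h0 1 (by omega)]; exact h.last
  cnt := by rw [h0 2 (by omega)]; exact h.cnt
  card := by rw [h7]; exact h.card

theorem rep_le (s : List α) (a : α) : rep s a ≤ s.length := by
  by_cases h : a ∈ s
  · exact (elt_eq_some_le (elt_rep h)).2
  · simp [rep, positions_eq_nil.2 h]

theorem lst_le (s : List α) (a : α) : lst s a ≤ s.length := by
  by_cases h : a ∈ s
  · exact (elt_eq_some_le (elt_lst h)).2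
  · simp [lst, positions_eq_nil.2 h]

theorem rep_ne_zero {s : List α} {a : α} (h : a ∈ s) : rep s a ≠ 0 := by
  have := elt_eq_some_le (elt_rep h)
  omega

theorem le_of_mem_flatMap_positions {s A : List α} {p : ℕ} (h : p ∈ A.flatMap (positions s)) :
    1 ≤ p ∧ p ≤ s.length := by
  simp only [List.mem_flatMap, mem_positions] at h
  obtain ⟨a, -, h⟩ := h
  exact elt_eq_some_le h

/-- The new element is linked in after the element number `q`, which ends `A` and the elements
equal to the new one. -/
theorem insertProg_listed_aux {s K A C : List α} {x : α} {m : Store} {B q : ℕ} {P : List ℕ}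
    (hL : Listed s K m) (h0 : m.var 0 = s.length + 1) (hB : s.length + 2 ≤ B)
    (hA : ∀ a ∈ A, a < x) (hC : ∀ a ∈ C, x < a)
    (hK : K = A ++ (if x ∈ s then [x] else []) ++ C)
    (h5 : m.var 5 ≤ s.length) (h6 : m.var 6 = rep s x)
    (hq : m.arr 1 (m.var 5) = q) (hP : 0 :: A.flatMap (positions s) ++ positions s x = P ++ [q]) :
    Does B (s ++ [x]) insertProg m fun m' c t => c = 0 ∧ t ≤ 60 ∧
      Listed (s ++ [x]) (A ++ x :: C) m' ∧ m'.var 11 = (if x ∈ s then m.var 11 else 0) ∧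
      (∀ a, 3 ≤ a → m'.arr a = m.arr a) ∧ (∀ v, v = 0 ∨ (8 ≤ v ∧ v ≤ 10) → m'.var v = m.var v) := by
  have hxs : m.var 6 = 0 ↔ x ∉ s := by
    rw [h6]
    refine ⟨fun h hx => rep_ne_zero hx h, fun h => by simp [rep, positions_eq_nil.2 h]⟩
  have hxA : x ∉ A := fun h => (hA x h).ne rfl
  have hxC : x ∉ C := fun h => (hC x h).ne rfl
  have hposx : (if x ∈ s then [x] else []).flatMap (positions s) = positions s x := by
    split_ifs with h
    · simp
    · simp [positions_eq_nil.2 h]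
  have hfm : 0 :: K.flatMap (positions s) = P ++ q :: C.flatMap (positions s) := by
    rw [hK, List.flatMap_append, List.flatMap_append, hposx, ← List.cons_append, ← List.cons_append,
      hP]
    simp
  have hmemle : ∀ p ∈ P ++ q :: C.flatMap (positions s), p ≤ s.length := by
    intro p hp
    rw [← hfm, List.mem_cons] at hp
    rcases hp with rfl | hp
    · omega
    · exact (le_of_mem_flatMap_positions hp).2
  have hq' : q ≤ s.length := hmemle q (by simp)
  have hchain := hL.chain
  rw [Store.HoldsList, hfm] at hchain
  simp only [List.append_assoc, List.cons_append] at hchain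
  have hf : m.arr 0 q ≤ s.length := by
    have := (List.isChain_split.1 hchain).2
    cases hQ : C.flatMap (positions s) with
    | nil =>
      rw [hQ] at this
      simp at this
      omega
    | cons p Q =>
      rw [hQ] at this
      simp only [List.cons_append, List.isChain_cons_cons] at this
      rw [this.1]
      exact hmemle p (by simp [hQ])
  have hnd : (P ++ q :: C.flatMap (positions s)).Nodup := by
    rw [← hfm, List.nodup_cons]
    refine ⟨fun h => ?_, nodup_flatMap_positions s hL.nodup⟩
    have := le_of_mem_flatMap_positions h
    omega
  -- The new number exceeds every number in the list, the head `0` included, so it is fresh.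
  have hins := isChain_insert (i := s.length + 1) hchain hnd fun h => by
    have := hmemle _ h
    omega
  have hKlen : K.length ≤ s.length := by
    rw [hL.length]
    exact List.toFinset_card_le s
  have h2 : m.var 6 ≠ 0 → m.arr 2 (m.var 6) + 1 ≤ B := by
    intro h
    rw [Ne, hxs, not_not] at h
    rw [h6, hL.cnt x ((hL.mem x).2 h)]
    have := List.count_le_length (a := x) (l := s)
    omega
  have hrep : (if m.var 6 = 0 then m.var 0 else m.var 6) = rep (s ++ [x]) x := by
    by_cases h : x ∈ s
    · rw [if_neg (by rw [hxs]; simpa using h), h6, rep_snoc h]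
    · rw [if_pos (hxs.2 h), rep_snoc_new h, h0]
  refine (insertProg_does m hq (by omega) (by omega) (by omega) ?_ (by omega) h2
    (by rw [hL.card]; omega)).mono ?_
  · rw [h6]
    exact (rep_le s x).trans (by omega)
  rintro m' c t ⟨rfl, g1, g2, g3, g4, g5, g6, g7, g8⟩
  rw [hrep] at g3
  simp only [hrep] at g4
  have hmem : ∀ a, a ∈ A ++ x :: C ↔ a ∈ s ++ [x] := by
    intro a
    have := hL.mem a
    rw [hK] at this
    by_cases h : x ∈ s
    · simp [h] at this ⊢
      rw [← this]
      tauto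
    · simp [h] at this ⊢
      rw [← this]
      tauto
  have hsne : ∀ a ∈ A ++ x :: C, a ≠ x → a ∈ s := by
    intro a ha hne
    have := (hmem a).1 ha
    simpa [hne] using this
  have hrepne : ∀ a ∈ A ++ x :: C, a ≠ x → rep (s ++ [x]) a ≠ rep (s ++ [x]) x := by
    intro a ha hne h
    have h1 := elt_rep ((hmem a).1 ha)
    rw [h, elt_rep (by simp)] at h1
    exact hne (Option.some.inj h1).symm
  refine ⟨rfl, g1, ⟨⟨?_, hmem⟩, ?_, ?_, ?_, ?_, ?_⟩, ?_, g7, g8⟩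
  · have hs := hL.sorted
    rw [hK] at hs
    simp only [List.pairwise_append, List.pairwise_cons, List.mem_cons] at hs ⊢
    refine ⟨hs.1.1, ⟨hC, hs.2.1⟩, ?_⟩
    rintro a ha b (rfl | hb)
    · exact hA a ha
    · exact (hA a ha).trans (hC b hb)
  · have e1 : ∀ D : List α, x ∉ D → D.flatMap (positions (s ++ [x])) = D.flatMap (positions s) := by
      intro D hD
      refine List.flatMap_congr fun a ha => ?_
      rw [positions_snoc, if_neg (by rintro rfl; exact hD ha), List.append_nil]
    rw [Store.HoldsList, List.flatMap_append, List.flatMap_cons, e1 A hxA, e1 C hxC, positions_snoc,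
      if_pos rfl, g2, h0]
    have e2 : 0 :: (A.flatMap (positions s) ++
        (positions s x ++ [s.length + 1] ++ C.flatMap (positions s))) ++ [0] =
        P ++ q :: (s.length + 1) :: (C.flatMap (positions s) ++ [0]) := by
      have := congrArg (· ++ (s.length + 1) :: (C.flatMap (positions s) ++ [0])) hP
      simpa using this
    rw [e2]
    exact hins
  · rw [g3, Function.update_of_ne (rep_ne_zero (by simp)).symm, hL.last_zero]
  · intro a ha
    rw [g3]
    by_cases hax : a = x
    · subst hax
      rw [Function.update_self, lst_snoc_self, h0]
    · rw [Function.update_of_ne (hrepne a ha hax), lst_snoc_of_ne s hax, rep_snoc (hsne a ha hax)]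
      exact hL.last a ((hL.mem a).2 (hsne a ha hax))
  · intro a ha
    rw [g4]
    by_cases hax : a = x
    · subst hax
      rw [if_pos rfl, List.count_append, List.count_singleton_self]
      by_cases h : a ∈ s
      · rw [if_neg (by rw [hxs]; simpa using h), rep_snoc h, hL.cnt a ((hL.mem a).2 h)]
      · rw [if_pos (hxs.2 h), List.count_eq_zero.2 h]
    · rw [if_neg (hrepne a ha hax), rep_snoc (hsne a ha hax),
        hL.cnt a ((hL.mem a).2 (hsne a ha hax)), List.count_append, List.count_singleton,
        if_neg (by simpa using fun h => hax h.symm), add_zero]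
  · have hlen := congrArg List.length hK
    rw [g5, hL.card]
    by_cases h : x ∈ s
    · rw [if_neg (by rw [hxs]; simpa using h)]
      simp [h] at hlen ⊢
      omega
    · rw [if_pos (hxs.2 h)]
      simp [h] at hlen ⊢
      omega
  · rw [g6]
    by_cases h : x ∈ s
    · rw [if_neg (by rw [hxs]; simpa using h), if_pos h]
    · rw [if_pos (hxs.2 h), if_neg h]

theorem insertProg_listed {s K : List α} {x : α} {m : Store} {B N c₀ : ℕ}
    (hL : Listed s K m) (h0 : m.var 0 = s.length + 1) (hB : s.length + 2 ≤ B)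
    (hF : Found (rep s) K x N m c₀) :
    Does B (s ++ [x]) insertProg m fun m' c t => c = 0 ∧ t ≤ 60 ∧
      (∃ K', Listed (s ++ [x]) K' m' ∧ (x ∈ s → K' = K)) ∧
      m'.var 11 = (if x ∈ s then m.var 11 else 0) ∧
      (∀ a, 3 ≤ a → m'.arr a = m.arr a) ∧ (∀ v, v = 0 ∨ (8 ≤ v ∧ v ≤ 10) → m'.var v = m.var v) := by
  obtain ⟨A, C, hA, hC, ⟨hK, h6, h5, -⟩ | ⟨hK, h6, h5, -⟩⟩ := hF
  · have hx : x ∉ s := by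
      rw [← hL.mem, hK, List.mem_append]
      rintro (h | h)
      · exact (hA x h).ne rfl
      · exact (hC x h).ne rfl
    have hnil := positions_eq_nil.2 hx
    have h5' : m.var 5 ≤ s.length ∧ ∃ P,
        0 :: A.flatMap (positions s) ++ positions s x = P ++ [m.arr 1 (m.var 5)] := by
      rcases List.eq_nil_or_concat A with rfl | ⟨A', a, rfl⟩
      · simp at h5
        -- With no smaller key, variable 5 is `0`; cell `0` of array 1 is `0` too, so the element is
        -- put directly after the head of the list.
        exact ⟨by omega, [], by simp [h5, hL.last_zero, hnil]⟩
      · simp at h5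
        have ha : a ∈ K := by simp [hK]
        obtain ⟨P, hP⟩ := exists_positions_eq_snoc ((hL.mem a).1 ha)
        refine ⟨h5 ▸ rep_le s a, 0 :: A'.flatMap (positions s) ++ P, ?_⟩
        simp [h5, hL.last a ha, hP, hnil]
    obtain ⟨h5', P, hP⟩ := h5'
    refine (insertProg_listed_aux hL h0 hB hA hC (by simpa [hx] using hK) h5'
      (by simp [h6, rep, hnil]) rfl hP).mono ?_
    rintro m' c t ⟨g1, g2, g3, g4⟩
    exact ⟨g1, g2, ⟨_, g3, fun h => absurd h hx⟩, g4⟩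
  · have hxK : x ∈ K := by simp [hK]
    have hx := (hL.mem x).1 hxK
    obtain ⟨P, hP⟩ := exists_positions_eq_snoc hx
    refine (insertProg_listed_aux (q := lst s x) (P := 0 :: A.flatMap (positions s) ++ P) hL h0 hB
      hA hC (by simpa [hx] using hK) (h5 ▸ rep_le s x) h6 (by rw [h5, hL.last x hxK])
      (by simp [hP])).mono ?_
    rintro m' c t ⟨g1, g2, g3, g4⟩
    exact ⟨g1, g2, ⟨_, g3, fun _ => hK.symm⟩, g4⟩

/-! ### The table while it ages, and the cost of a search. -/

/-- The part of the store that describes the table, which was made when `i₀` elements had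
arrived. -/
structure Tabled (s K : List α) (m : Store) (i₀ : ℕ) : Prop where
  table : Table (m.arr 3) (m.arr 4) (m.arr 5) (rep s) 0 K (m.var 10)
  le : i₀ ≤ s.length
  width : m.var 10 ≤ K.length * i₀.size + K.length
  expiry : m.var 11 = i₀ + K.length * i₀.size
  recent : s.length < i₀ + K.length * i₀.size ∨ s = []
  card_le : K.length ≤ i₀
  count_le : ∀ a ∈ K, (s.count a - (s.length - i₀)) * (K.length * i₀.size) ≤
    (m.arr 5 (rep s a) - m.arr 4 (rep s a)) * i₀
  one_le : ∀ a ∈ K, K.length * i₀.size ≤ (m.arr 5 (rep s a) - m.arr 4 (rep s a)) * i₀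

theorem size_le_self (n : ℕ) : n.size ≤ n := Nat.size_le.2 Nat.lt_two_pow_self

/-- While a table is in use, at most `i ^ 2` elements arrive, so the number of bits of the length at
most doubles. -/
theorem size_le_two_mul {k i n : ℕ} (hk : k ≤ i) (hn : n ≤ i + k * i.size) :
    n.size ≤ 2 * i.size := by
  rw [Nat.size_le, two_mul, pow_add]
  have h1 := Nat.lt_size_self i
  have h2 : k * i.size ≤ i * i := Nat.mul_le_mul hk (size_le_self i)
  nlinarith

theorem Listed.length_le {s K : List α} {m : Store} (h : Listed s K m) : K.length ≤ s.length := by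
  rw [h.length]
  exact List.toFinset_card_le s

theorem rebuildProg_tabled {s K : List α} {m : Store} {B : ℕ} (hL : Listed s K m)
    (h0 : m.var 0 = s.length) (hs : s ≠ []) (h8 : m.var 8 = s.length.size)
    (hB : (s.length + 1) ^ 4 ≤ B) :
    Does B s rebuildProg m fun m' c t => c = 0 ∧ t ≤ 120 * (K.length * s.length.size) + 30 ∧
      Listed s K m' ∧ Tabled s K m' s.length ∧ m'.var 8 = m.var 8 ∧ m'.var 9 = m.var 9 := by
  have hn : 0 < s.length := List.length_pos_iff.2 hs
  have hl := hL.length_le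
  have hz := size_le_self s.length
  have hz0 : 0 < s.length.size := Nat.size_pos.2 hn
  have hK0 : 0 < K.length := by
    obtain ⟨a, ha⟩ := List.exists_mem_of_ne_nil s hs
    exact List.length_pos_of_mem ((hL.mem a).2 ha)
  set n := s.length with hn'
  set S := K.length * n.size with hS
  have hSn : S ≤ n * n := Nat.mul_le_mul hl hz
  have hS0 : 0 < S := Nat.mul_pos hK0 hz0
  have hKS : K.length ≤ S := Nat.le_mul_of_pos_right _ hz0
  -- The largest product computed is a multiplicity times `S`, at most `n * n ^ 2`; the rest leaves
  -- room for the smaller terms.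
  have hB3 : n * (n * n) + n * n + 2 * n + 1 ≤ B := by
    refine le_trans ?_ hB
    have e : (n + 1) ^ 4 = n ^ 4 + 3 * n ^ 3 + 5 * n ^ 2 + 2 * n + (n * (n * n) + n * n + 2 * n + 1) := by
      ring
    omega
  have hw := hL.sum_weight S
  rw [← hn'] at hw
  have hn3 : 0 ≤ n * (n * n) := Nat.zero_le _
  refine (rebuildProg_does (ρ := rep s) (cnt := fun a => s.count a) (S := S) K m
    (by rw [hL.card, h8]) (by rw [hL.card]; omega) (by omega) hL.nodup_reps (fun a ha => ?_) hL.cnt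
    (fun a ha => ?_) (fun a ha => ?_) (by omega) hL.arr_zero hL.next ?_).mono ?_
  · have := rep_le s a
    exact ⟨rep_ne_zero ((hL.mem a).1 ha), by omega⟩
  · have h1 : s.count a ≤ n := List.count_le_length
    have h2 : s.count a * S ≤ n * (n * n) := Nat.mul_le_mul h1 hSn
    exact ⟨by omega, by omega⟩
  · rw [hL.last a ha]
    have := lst_le s a
    omega
  · rw [h0]
    omega
  rintro m' c t ⟨rfl, g2, g3, g4, g5, g6, g7, g8⟩
  rw [h0] at g3 g5 g8
  refine ⟨rfl, by omega, hL.congr g7 (g6 7 (by omega) (by omega)), ⟨g4, le_rfl, by omega, g8, ?_,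
    hl, fun a ha => ?_, fun a ha => ?_⟩, g6 8 (by omega) (by omega), g6 9 (by omega) (by omega)⟩
  · left
    omega
  -- By the extra cell, `count * S < weight * n`. This gives both lower bounds on the widths.
  all_goals
    rw [g5 a ha, Nat.add_sub_cancel_left, weight]
    have h1 := Nat.lt_mul_div_succ (s.count a * S) hn
    rw [mul_comm n] at h1
  · rw [← hn', Nat.sub_self, Nat.sub_zero]
    exact h1.le
  · refine le_trans ?_ h1.le
    exact Nat.le_mul_of_pos_left _ (List.count_pos_iff.2 ((hL.mem a).1 ha))

/-- The number of comparisons that a search makes. -/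
theorem Found.cost {s K : List α} {x : α} {m m' : Store} {i₀ c : ℕ} (hK : IsKeys s K)
    (hT : Tabled s K m i₀) (harr : m'.arr = m.arr) (hF : Found (rep s) K x (m.var 10) m' c) :
    (x ∉ s → c ≤ 4 * (K.length * i₀.size)) ∧
    (x ∈ s → ∃ k l, 1 ≤ k ∧ s.count x - K.length * i₀.size ≤ k ∧ 1 ≤ l ∧ s.length.size ≤ 2 * l ∧
      2 ^ c * k * l ≤ 2 * (l + 1) * s.length) := by
  obtain ⟨A, C, hA, hC, ⟨hAC, -, -, hc⟩ | ⟨hAC, -, -, hc⟩⟩ := hF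
  · have hx : x ∉ s := by
      rw [← hK.mem, hAC, List.mem_append]
      rintro (h | h)
      · exact (hA x h).ne rfl
      · exact (hC x h).ne rfl
    refine ⟨fun _ => ?_, fun h => absurd h hx⟩
    rcases hc with rfl | hc
    · omega
    -- For a new value a bound linear in the width of the table suffices, as this happens only once
    -- per class.
    have h1 : c < 2 ^ c := Nat.lt_two_pow_self
    have h2 := hT.width
    have h3 : K.length ≤ K.length * i₀.size := by
      rcases Nat.eq_zero_or_pos i₀ with h | h
      · have := hT.card_le
        omega
      · exact Nat.le_mul_of_pos_right _ (Nat.size_pos.2 h)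
    omega
  · have hxK : x ∈ K := by simp [hAC]
    refine ⟨fun h => absurd ((hK.mem x).1 hxK) h, fun hx => ?_⟩
    have hKpos : 0 < K.length := List.length_pos_of_mem hxK
    have hi : 0 < i₀ := hKpos.trans_le hT.card_le
    have hl : 0 < i₀.size := Nat.size_pos.2 hi
    have hn := hT.recent.resolve_right (by rintro rfl; simp at hx)
    have h1 := hT.count_le x hxK
    have h2 := hT.one_le x hxK
    rw [harr] at hc
    set w := m.arr 5 (rep s x) - m.arr 4 (rep s x)
    set d := s.count x - (s.length - i₀)
    -- The stale multiplicity `d` may be `0`; the bound `one_le` covers this case.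
    have hk : max 1 d * (K.length * i₀.size) ≤ w * i₀ := by
      rcases max_cases 1 d with h | h
      · rw [h.1, one_mul]
        exact h2
      · rw [h.1]
        exact h1
    refine ⟨max 1 d, i₀.size, le_max_left _ _, le_trans ?_ (le_max_right _ _), hl,
      size_le_two_mul hT.card_le hn.le, ?_⟩
    · omega
    -- Both `S` and the width carry the factor `K.length`, which cancels and leaves the ratio `(l +
    -- 1) / l`.
    · refine Nat.le_of_mul_le_mul_left ?_ hKpos
      calc K.length * (2 ^ c * max 1 d * i₀.size) = 2 ^ c * (max 1 d * (K.length * i₀.size)) := by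
            ring
        _ ≤ 2 ^ c * (w * i₀) := Nat.mul_le_mul_left _ hk
        _ = 2 ^ c * w * i₀ := by ring
        _ ≤ 2 * (K.length * i₀.size + K.length) * i₀ :=
            Nat.mul_le_mul_right _ (hc.trans (Nat.mul_le_mul_left _ hT.width))
        _ ≤ 2 * (K.length * i₀.size + K.length) * s.length := Nat.mul_le_mul_left _ hT.le
        _ = K.length * (2 * (i₀.size + 1) * s.length) := by ring

/-! ### The processing of one element. -/

/-- The number of bits of the number of the new element is computed. -/
def levelProg : Prog :=
  .branch (.op .lt (.var 9) (.var 0))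
    (.seq (.assign 8 (.op .add (.var 8) (.const 1)))
      (.assign 9 (.op .add (.op .mul (.const 2) (.var 9)) (.const 1)))) .skip

/-- The bit length grows exactly when the new number reaches `2 ^ n.size`, which variable 9 plus one
records; thus constant time suffices. -/
theorem levelProg_does {B : ℕ} {s : List α} (m : Store) {n : ℕ} (h0 : m.var 0 = n + 1)
    (h8 : m.var 8 = n.size) (h9 : m.var 9 + 1 = 2 ^ n.size) (hB : 2 * n + 3 ≤ B) :
    Does B s levelProg m fun m' c t => c = 0 ∧ t ≤ 20 ∧ m'.var 8 = (n + 1).size ∧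
      m'.var 9 + 1 = 2 ^ (n + 1).size ∧ m'.arr = m.arr ∧
      (∀ v, v ≠ 8 → v ≠ 9 → m'.var v = m.var v) := by
  have h2n : 2 ^ n.size ≤ 2 * n + 1 := by
    rcases Nat.eq_zero_or_pos n with rfl | hn
    · simp
    · obtain ⟨k, hk⟩ : ∃ k, n.size = k + 1 := ⟨n.size - 1, by have := Nat.size_pos.2 hn; omega⟩
      have : 2 ^ k ≤ n := Nat.lt_size.1 (by omega)
      rw [hk, pow_succ]
      omega
  have hnz := size_le_self n
  have hlt := Nat.lt_size_self n
  refine Does.branch ?_ (fun hv => ?_) (fun hv => ?_)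
  · have := Op.eval_lt_le (m.var 9) (m.var 0)
    simp only [Expr.Fits, Expr.val]
    omega
  · have hv : m.var 9 < m.var 0 := by
      by_contra hcon
      simp [Expr.val, Op.eval, hcon] at hv
    have hz : (n + 1).size = n.size + 1 := by
      refine le_antisymm (Nat.size_le.2 ?_) (Nat.lt_size.2 (by omega))
      rw [pow_succ]
      omega
    refine Does.seq (Does.assign (by simp [Expr.Fits, Expr.val, Op.eval]; omega) ?_)
    refine Does.assign (by simp [Expr.Fits, Expr.val, Op.eval]; omega) ?_
    refine ⟨rfl, by simp [Expr.size], ?_, ?_, rfl, fun v hv hv' => by simp [hv, hv']⟩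
    · simp [Expr.val, Op.eval, h8, hz]
    · simp [Expr.val, Op.eval, hz, pow_succ]
      omega
  · have hv : ¬m.var 9 < m.var 0 := by
      intro hcon
      simp [Expr.val, Op.eval, hcon] at hv
    have hz : (n + 1).size = n.size :=
      le_antisymm (Nat.size_le.2 (by omega)) (Nat.size_le_size (by omega))
    refine Does.skip ⟨rfl, by simp [Expr.size], by rw [h8, hz], by rw [h9, hz], rfl,
      fun _ _ _ => rfl⟩

/-- The algorithm. -/
def sortProg : Prog :=
  .seq levelProg (.seq searchProg (.seq insertProg
    (.branch (.op .lt (.var 0) (.var 11)) .skip rebuildProg)))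

/-- The state of the algorithm between two elements. -/
structure Ready (s K : List α) (m : Store) (i₀ : ℕ) : Prop where
  listed : Listed s K m
  tabled : Tabled s K m i₀
  size : m.var 8 = s.length.size
  pow : m.var 9 + 1 = 2 ^ s.length.size

theorem ready_nil : Ready ([] : List α) [] Store.init 0 where
  listed := ⟨⟨.nil, fun _ => .rfl⟩, by simp [Store.HoldsList, Store.init], rfl, by simp, by simp,
    rfl⟩
  tabled := ⟨rfl, le_rfl, by simp [Store.init], rfl, .inr rfl, le_rfl, by simp, by simp⟩
  size := rfl
  pow := by simp [Store.init]

/-- The time bound is amortized: `240` credits per element that arrives between two rebuilds pay for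
the second one, and a rebuild caused by a new value is charged separately. -/
theorem sortProg_does {s K : List α} {m : Store} {i₀ : ℕ} (h : Ready s K m i₀) (x : α) :
    Does ((s.length + 1 + 1) ^ 4) (s ++ [x]) sortProg (m.setVar 0 (s.length + 1)) fun m' c t =>
      (∃ K' i₁, Ready (s ++ [x]) K' m' i₁ ∧
        t + 240 * i₀ ≤ 40 * c + 300 + 240 * i₁ +
          if x ∈ s then 0 else 240 * (K'.length * (s.length + 1).size)) ∧
      (x ∉ s → c ≤ 4 * (K.length * i₀.size)) ∧
      (x ∈ s → ∃ k l, 1 ≤ k ∧ s.count x - K.length * i₀.size ≤ k ∧ 1 ≤ l ∧ s.length.size ≤ 2 * l ∧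
        2 ^ c * k * l ≤ 2 * (l + 1) * s.length) := by
  obtain ⟨hL, hT, h8, h9⟩ := h
  set n := s.length with hn
  have hKl := hL.length_le
  have hBB : 4 * (n * n) + 16 * n + 16 ≤ (n + 1 + 1) ^ 4 := by
    have e : (n + 1 + 1) ^ 4 = n ^ 4 + 8 * n ^ 3 + 20 * (n * n) + 16 * n +
      (4 * (n * n) + 16 * n + 16) := by ring
    omega
  generalize hB : (n + 1 + 1) ^ 4 = B at hBB ⊢
  have hi0 := hT.le
  have hS0 : K.length * i₀.size ≤ n * n :=
    Nat.mul_le_mul hKl ((size_le_self _).trans hi0)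
  have hwidth := hT.width
  refine Does.seq ((levelProg_does (n := n) _ (by simp) (by simpa using h8) (by simpa using h9)
    (by omega)).mono ?_)
  rintro m₁ c₁ t₁ ⟨rfl, a1, a2, a3, a4, a5⟩
  simp only [Store.setVar_arr] at a4
  have b0 : m₁.var 0 = n + 1 := by simp [a5]
  have b7 : m₁.var 7 = m.var 7 := by simp [a5]
  have b10 : m₁.var 10 = m.var 10 := by simp [a5]
  have b11 : m₁.var 11 = m.var 11 := by simp [a5]
  refine Does.seq ((searchProg_does (ρ := rep s) (K := K) (x := x) m₁ (by omega)
    (by rw [b0]; exact elt_snoc_last s x) (by omega) hL.sorted (fun a ha => ?_)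
    (by rw [a4, b10]; exact hT.table) (by omega)).mono ?_)
  · have := rep_le s a
    exact ⟨by rw [elt_snoc_of_le this]; exact elt_rep ((hL.mem a).1 ha), by omega⟩
  rintro m₂ c₂ t₂ ⟨d1, d2, d3, d4, d5⟩
  have e2 : m₂.arr = m.arr := d1.trans a4
  have hL₂ : Listed s K m₂ := hL.congr (by simp [e2]) (by rw [d3 7 (by omega), b7])
  refine Does.seq ((insertProg_listed hL₂ (d2.trans b0) (by omega) d5).mono ?_)
  rintro m₃ c₃ t₃ ⟨rfl, f1, ⟨K', hL₃, hKK⟩, f4, f5, f6⟩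
  rw [b10] at d5
  have hcost := d5.cost hL.toIsKeys hT e2
  have g0 : m₃.var 0 = n + 1 := by rw [f6 0 (by omega), d2, b0]
  have g8 : m₃.var 8 = (n + 1).size := by rw [f6 8 (by omega), d3 8 (by omega), a2]
  have g9 : m₃.var 9 + 1 = 2 ^ (n + 1).size := by rw [f6 9 (by omega), d3 9 (by omega), a3]
  have g10 : m₃.var 10 = m.var 10 := by rw [f6 10 (by omega), d3 10 (by omega), b10]
  have g11 : m₃.var 11 = if x ∈ s then m.var 11 else 0 := by rw [f4, d3 11 (by omega), b11]
  have hlen : (s ++ [x]).length = n + 1 := by simp [hn]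
  have hexp := hT.expiry
  have h11 : m₃.var 11 ≤ B := by
    rw [g11]
    split_ifs <;> omega
  have hbound : x ∈ s → (n + 1).size ≤ 2 * i₀.size := by
    intro hx
    refine size_le_two_mul hT.card_le ?_
    have := hT.recent.resolve_right (by rintro rfl; simp at hx)
    omega
  refine Does.branch ?_ (fun hv => ?_) (fun hv => ?_)
  · have := Op.eval_lt_le (m₃.var 0) (m₃.var 11)
    simp only [Expr.Fits, Expr.val]
    omega
  · have hv : m₃.var 0 < m₃.var 11 := by
      by_contra hcon
      simp [Expr.val, Op.eval, hcon] at hv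
    have hx : x ∈ s := by
      by_contra hx
      rw [g11, if_neg hx] at hv
      omega
    rw [g11, if_pos hx] at hv
    obtain rfl := hKK hx
    have hreps : ∀ a ∈ K', rep (s ++ [x]) a = rep s a := fun a ha => rep_snoc ((hL.mem a).1 ha) x
    have hcnt : ∀ a, (s ++ [x]).count a ≤ s.count a + 1 := by
      intro a
      rw [List.count_append, List.count_singleton]
      split_ifs <;> omega
    have hT' : Tabled (s ++ [x]) K' m₃ i₀ := by
      refine ⟨?_, by omega, by rw [g10]; exact hwidth, by rw [g11, if_pos hx]; exact hexp,
        .inl (by omega), hT.card_le, fun a ha => ?_, fun a ha => ?_⟩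
      · rw [f5 3 (by omega), f5 4 (by omega), f5 5 (by omega), e2, g10]
        exact hT.table.congr (fun _ _ _ => rfl) hreps (fun _ _ => rfl) (fun _ _ => rfl)
      -- An arrival raises a multiplicity by at most one and the age of the table by one, so their
      -- difference does not grow.
      · rw [f5 4 (by omega), f5 5 (by omega), e2, hreps a ha, hlen]
        refine le_trans (Nat.mul_le_mul_right _ ?_) (hT.count_le a ha)
        have := hcnt a
        omega
      · rw [f5 4 (by omega), f5 5 (by omega), e2, hreps a ha]
        exact hT.one_le a ha
    refine Does.skip ⟨⟨K', i₀, ⟨hL₃, hT', by rw [hlen, g8], by rw [hlen, g9]⟩, ?_⟩, ?_⟩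
    · simp only [Expr.size]
      omega
    · simpa using hcost
  · have hv : ¬m₃.var 0 < m₃.var 11 := by
      intro hcon
      simp [Expr.val, Op.eval, hcon] at hv
    refine (rebuildProg_tabled hL₃ (by rw [g0, hlen]) (by simp) (by rw [g8, hlen])
      (by rw [hlen, hB])).mono ?_
    rintro m₄ c₄ t₄ ⟨rfl, k1, hL₄, hT₄, k8, k9⟩
    rw [hlen] at k1 hT₄
    refine ⟨⟨K', n + 1, ⟨hL₄, hT₄, by rw [k8, hlen, g8], by rw [k9, hlen, g9]⟩,
      ?_⟩, by simpa using hcost⟩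
    simp only [Expr.size]
    split_ifs with hx
    · rw [g11, if_pos hx] at hv
      -- The new table is at most about twice the old one, and at least `K.length * i₀.size`
      -- elements have arrived since `i₀`, so `240 * (i₁ - i₀)` covers the `120` steps per unit of
      -- the new `S`.
      have h1 : K'.length * (n + 1).size ≤ 2 * (K.length * i₀.size) := by
        rw [hKK hx, mul_left_comm]
        exact Nat.mul_le_mul_left _ (hbound hx)
      omega
    · omega

/-! ### The potential that sums the comparisons. -/

open Real

/-- `n log n` in bits. -/
noncomputable def phi (n : ℕ) : ℝ := n * logb 2 n

/-- What it costs that the table counts `L` occurrences too few. -/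
noncomputable def lagCost (L k : ℕ) : ℝ :=
  ∑ j ∈ Finset.range k, (logb 2 ((j + 1 : ℕ) : ℝ) - logb 2 ((j - L : ℕ) : ℝ))

/-- The convention `logb 2 0 = 0` makes this hold at `0` as well, so truncated differences `j - L`
need no separate treatment. -/
theorem logb_two_nat_mono {i j : ℕ} (h : i ≤ j) : logb 2 (i : ℝ) ≤ logb 2 (j : ℝ) := by
  rcases Nat.eq_zero_or_pos i with rfl | hi
  · rcases Nat.eq_zero_or_pos j with rfl | hj
    · exact le_rfl
    · rw [Nat.cast_zero, logb_zero]
      exact logb_nonneg (by norm_num) (by exact_mod_cast hj)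
  · exact logb_le_logb_of_le (by norm_num) (by exact_mod_cast hi) (by exact_mod_cast h)

theorem logb_two_nat_nonneg (n : ℕ) : 0 ≤ logb 2 (n : ℝ) := by
  simpa using logb_two_nat_mono (Nat.zero_le n)

/-- For `L = 0` the sum telescopes to `logb 2 k`. Each further unit of lag adds another telescoping
sum, at most `logb 2 k`. -/
theorem lagCost_le (L k : ℕ) : lagCost L k ≤ (L + 1) * logb 2 k := by
  induction L with
  | zero =>
    have := Finset.sum_range_sub (fun j : ℕ => logb 2 (j : ℝ)) k
    simp only [lagCost, Nat.sub_zero]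
    rw [this]
    simp
  | succ L ih =>
    have h1 := Finset.sum_range_sub (fun j : ℕ => logb 2 ((j - 1 - L : ℕ) : ℝ)) k
    have h2 : lagCost (L + 1) k = lagCost L k +
        ∑ j ∈ Finset.range k, (logb 2 ((j + 1 - 1 - L : ℕ) : ℝ) - logb 2 ((j - 1 - L : ℕ) : ℝ)) := by
      rw [lagCost, lagCost, ← Finset.sum_add_distrib]
      refine Finset.sum_congr rfl fun j _ => ?_
      rw [Nat.add_sub_cancel, show j - (L + 1) = j - 1 - L by omega]
      ring
    have h3 : logb 2 ((k - 1 - L : ℕ) : ℝ) ≤ logb 2 (k : ℝ) := logb_two_nat_mono (by omega)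
    rw [h2, h1]
    simp only [zero_tsub, Nat.cast_zero, logb_zero, sub_zero]
    push_cast
    linarith

/-- The difference is `log n + (n + 1) log (1 + 1 / n)` in base 2, and `(n + 1) ln (1 + 1 / n) ≥ 1`.
In `phi_sub_le` the companion fact is `n ln (1 + 1 / n) ≤ 1`. -/
theorem add_inv_le_phi_sub {n : ℕ} (hn : 0 < n) :
    logb 2 n + (log 2)⁻¹ ≤ phi (n + 1) - phi n := by
  have hn' : (0 : ℝ) < n := by exact_mod_cast hn
  have h2 : 0 < log 2 := log_pos (by norm_num)
  have h := Real.one_sub_inv_le_log_of_pos (x := ((n : ℝ) + 1) / n) (by positivity)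
  rw [log_div (by positivity) (by positivity), inv_div] at h
  have h' : 1 ≤ ((n : ℝ) + 1) * (log (n + 1) - log n) := by
    have := mul_le_mul_of_nonneg_left h (by positivity : (0 : ℝ) ≤ n + 1)
    refine le_trans (le_of_eq ?_) this
    field_simp
    ring
  have e : phi (n + 1) - phi n - (logb 2 n + (log 2)⁻¹) =
      (log 2)⁻¹ * (((n : ℝ) + 1) * (log (n + 1) - log n) - 1) := by
    simp only [phi, logb]
    push_cast
    field_simp
    ring
  have : 0 ≤ (log 2)⁻¹ * (((n : ℝ) + 1) * (log (n + 1) - log n) - 1) :=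
    mul_nonneg (by positivity) (by linarith)
  linarith

theorem phi_sub_le {n : ℕ} (hn : 0 < n) :
    phi (n + 1) - phi n ≤ logb 2 ((n + 1 : ℕ) : ℝ) + (log 2)⁻¹ := by
  have hn' : (0 : ℝ) < n := by exact_mod_cast hn
  have h2 : 0 < log 2 := log_pos (by norm_num)
  have h := Real.log_le_sub_one_of_pos (x := ((n : ℝ) + 1) / n) (by positivity)
  rw [log_div (by positivity) (by positivity)] at h
  have h' : (n : ℝ) * (log (n + 1) - log n) ≤ 1 := by
    refine (mul_le_mul_of_nonneg_left h hn'.le).trans (le_of_eq ?_)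
    field_simp
    ring
  have e : logb 2 ((n + 1 : ℕ) : ℝ) + (log 2)⁻¹ - (phi (n + 1) - phi n) =
      (log 2)⁻¹ * (1 - n * (log (n + 1) - log n)) := by
    simp only [phi, logb]
    push_cast
    field_simp
    ring
  have : 0 ≤ (log 2)⁻¹ * (1 - n * (log (n + 1) - log n)) :=
    mul_nonneg (by positivity) (by linarith)
  linarith

theorem phi_zero : phi 0 = 0 := by simp [phi]

theorem phi_one : phi 1 = 0 := by simp [phi]

theorem phi_le_succ (n : ℕ) : phi n ≤ phi (n + 1) :=
  mul_le_mul (by simp) (logb_two_nat_mono (Nat.le_succ n)) (logb_two_nat_nonneg n) (by positivity)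

theorem sum_count_snoc (F : ℕ → ℝ) (hF : F 0 = 0) (s : List α) (x : α) :
    ∑ a ∈ (s ++ [x]).toFinset, F ((s ++ [x]).count a) =
      ∑ a ∈ s.toFinset, F (s.count a) + (F (s.count x + 1) - F (s.count x)) := by
  have h1 : ∑ a ∈ s.toFinset, F (s.count a) = ∑ a ∈ (s ++ [x]).toFinset, F (s.count a) := by
    refine Finset.sum_subset (fun a ha => ?_) fun a _ ha => ?_
    · simp only [List.mem_toFinset, List.mem_append] at ha ⊢
      exact .inl ha
    · rw [List.count_eq_zero.2 (by simpa using ha), hF]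
  rw [h1, ← sub_eq_iff_eq_add', ← Finset.sum_sub_distrib, Finset.sum_eq_single x]
  · simp
  · intro a _ ha
    simp [ha.symm]
  · simp

theorem distinct_snoc (s : List α) (x : α) :
    distinct (s ++ [x]) = distinct s + if x ∈ s then 0 else 1 := by
  have : (s ++ [x]).toFinset = insert x s.toFinset := by
    ext a
    simp
  rw [distinct, distinct, this, Finset.card_insert_eq_ite]
  simp only [List.mem_toFinset]
  split_ifs <;> rfl

/-- The entropy in terms of `n log n`. -/
theorem entropy_mul_length (s : List α) :
    entropy s * s.length = phi s.length - ∑ a ∈ s.toFinset, phi (s.count a) := by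
  rcases s.length.eq_zero_or_pos with h | hn
  · rw [List.length_eq_zero_iff] at h
    simp [h, phi_zero]
  have hn' : (0 : ℝ) < s.length := by exact_mod_cast hn
  have h1 : (s.length : ℝ) = ∑ a ∈ s.toFinset, (s.count a : ℝ) := by
    have := Multiset.toFinset_sum_count_eq (s : Multiset α)
    simp only [Multiset.coe_count, Multiset.coe_card] at this
    exact_mod_cast this.symm
  have h2 : phi s.length = ∑ a ∈ s.toFinset, (s.count a : ℝ) * logb 2 s.length := by
    rw [← Finset.sum_mul, ← h1, phi]
  rw [h2, ← Finset.sum_sub_distrib, entropy, Finset.sum_mul]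
  refine Finset.sum_congr rfl fun a ha => ?_
  have hc : (0 : ℝ) < s.count a := by
    exact_mod_cast List.count_pos_iff.2 (by simpa using ha)
  rw [logb_div hn'.ne' hc.ne', phi]
  field_simp

theorem entropy_nonneg (s : List α) : 0 ≤ entropy s := by
  refine Finset.sum_nonneg fun a ha => mul_nonneg (by positivity) ?_
  have hc : (0 : ℝ) < s.count a := by
    exact_mod_cast List.count_pos_iff.2 (by simpa using ha)
  refine logb_nonneg (by norm_num) ((one_le_div hc).2 ?_)
  exact_mod_cast List.count_le_length

/-- The bound on the number of comparisons when `L` is at least the number of distinct elements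
times the number of bits of the length. -/
noncomputable def comparisonBound (s : List α) (L : ℕ) : ℝ :=
  phi s.length - ∑ a ∈ s.toFinset, phi (s.count a) + s.length +
    ∑ i ∈ Finset.range s.length, 4 / (i.size : ℝ) +
    ∑ a ∈ s.toFinset, lagCost L (s.count a) + 4 * L * distinct s

theorem search_cost_le {c k l n z L : ℕ} (hk : 1 ≤ k) (hzk : z - L ≤ k) (hl : 1 ≤ l) (hn : 1 ≤ n)
    (hnl : n.size ≤ 2 * l) (h : 2 ^ c * k * l ≤ 2 * (l + 1) * n) :
    (c : ℝ) ≤ 1 + logb 2 n - logb 2 ((z - L : ℕ) : ℝ) + 4 / (n.size : ℝ) := by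
  have hk' : (0 : ℝ) < k := by exact_mod_cast hk
  have hl' : (0 : ℝ) < l := by exact_mod_cast hl
  have hn' : (0 : ℝ) < n := by exact_mod_cast hn
  have hs' : (0 : ℝ) < n.size := by exact_mod_cast Nat.size_pos.2 hn
  have h' : (2 : ℝ) ^ c * k * l ≤ 2 * (l + 1) * n := by exact_mod_cast h
  have h1 := logb_le_logb_of_le (b := 2) (by norm_num) (by positivity) h'
  rw [logb_mul (by positivity) hl'.ne', logb_mul (by positivity) hk'.ne',
    logb_mul (by positivity) hn'.ne', logb_mul (by norm_num) (by positivity), logb_pow,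
    logb_self_eq_one (by norm_num)] at h1
  have h2 : logb 2 ((l : ℝ) + 1) - logb 2 l ≤ 4 / n.size := by
    rw [← logb_div (by positivity) hl'.ne', logb]
    have h3 := Real.log_le_sub_one_of_pos (x := ((l : ℝ) + 1) / l) (by positivity)
    have h4 : ((l : ℝ) + 1) / l - 1 = 1 / l := by field_simp; ring
    -- This and `n.size ≤ 2 * l` turn `1 / (l * log 2)` into `4 / n.size`.
    have h5 : (1 : ℝ) / 2 ≤ log 2 := by linarith [Real.log_two_gt_d9]
    have h6 : (n.size : ℝ) ≤ 2 * l := by exact_mod_cast hnl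
    rw [h4] at h3
    calc log (((l : ℝ) + 1) / l) / log 2 ≤ (1 / l) / (1 / 2) :=
          div_le_div₀ (by positivity) h3 (by norm_num) h5
      _ = 4 / (2 * l) := by field_simp; norm_num
      _ ≤ 4 / n.size := div_le_div_of_nonneg_left (by norm_num) hs' h6
  have h3 := logb_two_nat_mono hzk
  linarith

/-- The potential grows by at least the cost of the search; `L` stays fixed although the lag `S`
varies. -/
theorem comparisonBound_snoc {s : List α} {x : α} {c L S : ℕ} (hS : S ≤ L)
    (h1 : x ∉ s → c ≤ 4 * S)
    (h2 : x ∈ s → ∃ k l, 1 ≤ k ∧ s.count x - S ≤ k ∧ 1 ≤ l ∧ s.length.size ≤ 2 * l ∧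
        2 ^ c * k * l ≤ 2 * (l + 1) * s.length) :
    comparisonBound s L + c ≤ comparisonBound (s ++ [x]) L := by
  have e1 := sum_count_snoc phi phi_zero s x
  have e2 := sum_count_snoc (lagCost L) (by simp [lagCost]) s x
  have e3 : lagCost L (s.count x + 1) - lagCost L (s.count x) =
      logb 2 ((s.count x + 1 : ℕ) : ℝ) - logb 2 ((s.count x - L : ℕ) : ℝ) := by
    rw [lagCost, Finset.sum_range_succ, ← lagCost]
    ring
  have hlen : (s ++ [x]).length = s.length + 1 := by simp
  simp only [comparisonBound]
  rw [e1, e2, e3, hlen, Finset.sum_range_succ, distinct_snoc]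
  by_cases hx : x ∈ s
  · obtain ⟨k, l, hk, hzk, hl, hnl, h⟩ := h2 hx
    have hn : 0 < s.length := List.length_pos_of_mem hx
    have hc := search_cost_le (z := s.count x) (L := L) hk (by omega) hl hn hnl h
    -- The two terms `(log 2)⁻¹` cancel, and the `log (count + 1)` from `phi` cancels against the
    -- one in `lagCost`. What is left is the bound `hc`.
    have h3 := add_inv_le_phi_sub hn
    have h4 := phi_sub_le (List.count_pos_iff.2 hx)
    simp only [hx, if_true]
    push_cast at *
    linarith
  · have h3 := phi_le_succ s.length
    have h4 : (c : ℝ) ≤ 4 * L := by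
      have := h1 hx
      exact_mod_cast this.trans (by omega)
    have h5 : (0 : ℝ) ≤ 4 / (s.length.size : ℝ) := by positivity
    simp only [List.count_eq_zero.2 hx, phi_zero, phi_one, hx, if_false, zero_add, Nat.zero_sub,
      Nat.cast_one, logb_one, Nat.cast_zero, logb_zero]
    push_cast
    linarith

/-! ### Whole runs and the size of the error terms. -/

/-- Every `L` is allowed that bounds the final `S`. Such an `L` also bounds all earlier ones, so the
induction can use a single `L`. -/
theorem exists_run (s : List α) : ∃ K m i₀ c t, Ready s K m i₀ ∧ Run 4 sortProg s m c t ∧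
    ∀ L, distinct s * s.length.size ≤ L → (c : ℝ) ≤ comparisonBound s L ∧
      t ≤ 40 * c + 300 * s.length + 240 * i₀ + 240 * (distinct s * L) := by
  induction s using List.reverseRecOn with
  | nil =>
    refine ⟨[], Store.init, 0, 0, 0, ready_nil, .nil, fun L _ => ?_⟩
    simp [comparisonBound, phi, distinct]
  | append_singleton s x ih =>
    obtain ⟨K, m, i₀, c, t, hR, hrun, hL⟩ := ih
    obtain ⟨m', c', t', hex, ⟨K', i₁, hR', ht⟩, h1, h2⟩ := sortProg_does hR x
    refine ⟨K', m', i₁, c + c', t + t', hR', .snoc x hrun hex, fun L hL' => ?_⟩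
    have hlen : (s ++ [x]).length = s.length + 1 := by simp
    have hd := distinct_snoc s x
    have hK := hR.listed.length
    have hK' := hR'.listed.length
    have hz : s.length.size ≤ (s.length + 1).size := Nat.size_le_size (Nat.le_succ _)
    rw [hlen] at hL'
    have hdL : distinct s * s.length.size ≤ L :=
      (Nat.mul_le_mul (by omega) hz).trans hL'
    have hS : K.length * i₀.size ≤ L := by
      rw [hK]
      exact (Nat.mul_le_mul_left _ (Nat.size_le_size hR.tabled.le)).trans hdL
    obtain ⟨q1, q2⟩ := hL L hdL
    refine ⟨?_, ?_⟩
    · have := comparisonBound_snoc hS h1 h2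
      push_cast
      linarith
    · rw [hlen, hd]
      rw [hK'] at ht
      split_ifs at ht hd ⊢ with hx
      · simp only [Nat.add_zero]
        omega
      · rw [Nat.add_mul, Nat.one_mul]
        omega

theorem comparisonBound_le {s : List α} {L : ℕ} :
    comparisonBound s L ≤ (entropy s + 1) * s.length +
      (∑ i ∈ Finset.range s.length, 4 / (i.size : ℝ) +
        distinct s * ((L + 1) * logb 2 s.length) + 4 * L * distinct s) := by
  have h : ∑ a ∈ s.toFinset, lagCost L (s.count a) ≤
      distinct s * ((L + 1) * logb 2 s.length) := by
    rw [distinct, ← nsmul_eq_mul]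
    refine Finset.sum_le_card_nsmul _ _ _ fun a _ => (lagCost_le L _).trans ?_
    exact mul_le_mul_of_nonneg_left (logb_two_nat_mono List.count_le_length) (by positivity)
  rw [comparisonBound, add_mul, entropy_mul_length, one_mul]
  linarith

/-- The lower order term for at most `f n` distinct elements. -/
noncomputable def excess (f : ℕ → ℝ) (n : ℕ) : ℝ :=
  ∑ i ∈ Finset.range n, 4 / (i.size : ℝ) + |f n| * ((|f n| * n.size + 1) * logb 2 n) +
    4 * (|f n| * n.size) * |f n|

theorem tendsto_size_atTop : Tendsto Nat.size atTop atTop :=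
  tendsto_atTop_atTop.2 fun b => ⟨2 ^ b, fun _ h => (Nat.lt_size.2 h).le⟩

theorem size_le_logb {n : ℕ} (hn : 2 ≤ n) : (n.size : ℝ) ≤ 2 * logb 2 n := by
  obtain ⟨k, hk⟩ : ∃ k, n.size = k + 1 := ⟨n.size - 1, by
    have := Nat.size_pos.2 (show 0 < n by omega); omega⟩
  have h1 : 2 ^ k ≤ n := Nat.lt_size.1 (by omega)
  have h2 : (k : ℝ) ≤ logb 2 n := by
    rw [le_logb_iff_rpow_le (by norm_num) (by exact_mod_cast (show 0 < n by omega)), rpow_natCast]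
    exact_mod_cast h1
  have h3 : 1 ≤ logb 2 (n : ℝ) := by
    simpa using logb_two_nat_mono hn
  rw [hk]
  push_cast
  linarith

/-- The hypothesis makes both `|f n| * logb 2 n` and `|f n| * n.size` little-o of `√n`; the products
in `excess` are then `o(n)`. -/
theorem excess_isLittleO {f : ℕ → ℝ} (hf : f =o[atTop] (fun n : ℕ => √(n : ℝ) / logb 2 n)) :
    excess f =o[atTop] (fun n : ℕ => (n : ℝ)) := by
  have hsq : (fun n : ℕ => √(n : ℝ) * √(n : ℝ)) = fun n : ℕ => (n : ℝ) := by
    funext n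
    exact Real.mul_self_sqrt (by positivity)
  have hsqrt : (fun n : ℕ => √(n : ℝ)) =O[atTop] (fun n : ℕ => (n : ℝ)) := by
    refine IsBigO.of_bound 1 (Eventually.of_forall fun n => ?_)
    rw [one_mul, norm_of_nonneg (by positivity), norm_of_nonneg (by positivity)]
    rcases Nat.eq_zero_or_pos n with rfl | hn
    · simp
    · rw [Real.sqrt_le_left (by positivity)]
      have : (1 : ℝ) ≤ n := by exact_mod_cast hn
      nlinarith
  have hlog : (fun n => |f n| * logb 2 n) =o[atTop] (fun n : ℕ => √(n : ℝ)) := by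
    refine (hf.abs_left.mul_isBigO (isBigO_refl (fun n : ℕ => logb 2 (n : ℝ)) atTop)).trans_isBigO ?_
    refine IsBigO.of_bound 1 (Eventually.of_forall fun n => ?_)
    rw [one_mul]
    by_cases h : logb 2 (n : ℝ) = 0
    · simp [h]
    · rw [div_mul_cancel₀ _ h]
  have hsizelog : (fun n : ℕ => (n.size : ℝ)) =O[atTop] (fun n : ℕ => logb 2 (n : ℝ)) := by
    refine IsBigO.of_bound 2 ((eventually_ge_atTop 2).mono fun n hn => ?_)
    rw [norm_of_nonneg (by positivity), norm_of_nonneg (logb_two_nat_nonneg n)]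
    exact size_le_logb hn
  have hsize : (fun n => |f n| * n.size) =o[atTop] (fun n : ℕ => √(n : ℝ)) :=
    ((isBigO_refl (fun n => |f n|) atTop).mul hsizelog).trans_isLittleO hlog
  have hone : (fun n => |f n|) =o[atTop] (fun n : ℕ => √(n : ℝ)) := by
    refine IsBigO.trans_isLittleO ?_ hsize
    refine IsBigO.of_bound 1 ((eventually_ge_atTop 1).mono fun n hn => ?_)
    have : (1 : ℝ) ≤ n.size := by exact_mod_cast Nat.size_pos.2 hn
    rw [one_mul, norm_of_nonneg (by positivity), norm_of_nonneg (by positivity)]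
    exact le_mul_of_one_le_right (abs_nonneg _) this
  have h1 : (fun n => ∑ i ∈ Finset.range n, 4 / (i.size : ℝ)) =o[atTop] (fun n : ℕ => (n : ℝ)) := by
    -- The single terms tend to `0`, hence so do their Cesàro means.
    have h0 : Tendsto (fun i : ℕ => 4 / (i.size : ℝ)) atTop (nhds 0) :=
      (tendsto_natCast_atTop_atTop.comp tendsto_size_atTop).const_div_atTop 4
    have h := h0.cesaro
    rw [isLittleO_iff_tendsto' ((eventually_ge_atTop 1).mono fun n hn h => by
      have : (n : ℝ) ≠ 0 := by positivity
      exact absurd h this)]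
    refine h.congr fun n => ?_
    rw [div_eq_inv_mul]
  have h2 : (fun n => |f n| * ((|f n| * n.size + 1) * logb 2 n)) =o[atTop]
      (fun n : ℕ => (n : ℝ)) := by
    have h := (hsize.mul hlog).add (by rw [hsq]; exact hlog.trans_isBigO hsqrt)
    rw [hsq] at h
    refine h.congr_left fun n => ?_
    ring
  have h3 : (fun n => 4 * (|f n| * n.size) * |f n|) =o[atTop] (fun n : ℕ => (n : ℝ)) := by
    have h := (hsize.mul hone).const_mul_left 4
    rw [hsq] at h
    refine h.congr_left fun n => ?_
    ring
  exact (h1.add h2).add h3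

end OnlineSort

/-! ### The theorem. -/

theorem mainTheorem9 :
    ∃ (p : OnlineSort.Prog) (b : ℕ) (C : ℝ), OnlineSort.SortsStably.{u} b p ∧
      ∀ f : ℕ → ℝ, f =o[atTop] (fun n : ℕ => √(n : ℝ) / Real.logb 2 n) →
        (∃ g : ℕ → ℝ, g =o[atTop] (fun n : ℕ => (n : ℝ)) ∧
          ∀ (α : Type u) [LinearOrder α] (s : List α) (m : OnlineSort.Store) (c t : ℕ),
            (OnlineSort.distinct s : ℝ) ≤ f s.length → OnlineSort.Run b p s m c t →
              (c : ℝ) ≤ (OnlineSort.entropy s + 1) * s.length + g s.length) ∧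
        (∃ N : ℕ,
          ∀ (α : Type u) [LinearOrder α] (s : List α) (m : OnlineSort.Store) (c t : ℕ),
            N ≤ s.length → (OnlineSort.distinct s : ℝ) ≤ f s.length → OnlineSort.Run b p s m c t →
              (t : ℝ) ≤ C * ((OnlineSort.entropy s + 1) * s.length)) := by
  open OnlineSort in
  -- Once `excess f n ≤ n`, the time is at most `40 * ((H + 1) * n + n) + 540 * n + 60 * n`, and `40
  -- + 40 + 540 + 60 = 680`.
  refine ⟨sortProg, 4, 680, fun α _ s => ?_, fun f hf => ?_⟩
  · obtain ⟨K, m, i₀, c, t, hR, hrun, -⟩ := exists_run s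
    refine ⟨⟨m, c, t, hrun⟩, fun m' c' t' hrun' => ?_⟩
    obtain ⟨rfl, -, -⟩ := hrun.deterministic hrun'
    exact ⟨_, isStableSort_flatMap hR.listed.sorted hR.listed.mem, hR.listed.chain⟩
  have key : ∀ (α : Type u) [LinearOrder α] (s : List α) (m : Store) (c t : ℕ),
      (distinct s : ℝ) ≤ f s.length → Run 4 sortProg s m c t →
      (c : ℝ) ≤ (entropy s + 1) * s.length + excess f s.length ∧
        (t : ℝ) ≤ 40 * c + 540 * s.length + 60 * excess f s.length := by
    intro α _ s m c t hd hrun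
    obtain ⟨K, m', i₀, c', t', hR, hrun', hL⟩ := exists_run s
    obtain ⟨rfl, rfl, rfl⟩ := hrun.deterministic hrun'
    obtain ⟨h1, h2⟩ := hL _ le_rfl
    have hd' := hd.trans (le_abs_self (f s.length))
    have hlog := logb_two_nat_nonneg s.length
    have hL' : ((distinct s * s.length.size : ℕ) : ℝ) ≤ |f s.length| * s.length.size := by
      push_cast
      gcongr
    have h3 : (distinct s : ℝ) *
        ((((distinct s * s.length.size : ℕ) : ℝ) + 1) * Real.logb 2 s.length) ≤
        |f s.length| * ((|f s.length| * s.length.size + 1) * Real.logb 2 s.length) := by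
      gcongr
    have h4 : 4 * ((distinct s * s.length.size : ℕ) : ℝ) * distinct s ≤
        4 * (|f s.length| * s.length.size) * |f s.length| := by
      gcongr
    have h5 : 0 ≤ ∑ i ∈ Finset.range s.length, 4 / (i.size : ℝ) :=
      Finset.sum_nonneg fun i _ => by positivity
    have h6 : 0 ≤ |f s.length| * ((|f s.length| * s.length.size + 1) * Real.logb 2 s.length) := by
      positivity
    constructor
    · have := h1.trans comparisonBound_le
      rw [excess]
      linarith
    -- As `i₀ ≤ n`, the linear terms give `300 + 240 = 540`; the term `240 * σ * L` is at most `60`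
    -- times the last summand of `excess`.
    · have h7 : (t : ℝ) ≤ 40 * c + 300 * s.length + 240 * i₀ +
          240 * (distinct s * ((distinct s * s.length.size : ℕ) : ℝ)) := by exact_mod_cast h2
      have h8 : (i₀ : ℝ) ≤ s.length := by exact_mod_cast hR.tabled.le
      rw [excess]
      linarith
  have ho := excess_isLittleO hf
  refine ⟨⟨excess f, ho, fun α _ s m c t hd hrun => (key α s m c t hd hrun).1⟩, ?_⟩
  obtain ⟨N, hN⟩ := eventually_atTop.1 (ho.bound one_pos)
  refine ⟨N, fun α _ s m c t hs hd hrun => ?_⟩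
  obtain ⟨h1, h2⟩ := key α s m c t hd hrun
  have h3 := (le_abs_self _).trans (hN _ hs)
  rw [one_mul, Real.norm_of_nonneg (by positivity)] at h3
  have h4 : 0 ≤ entropy s * s.length := mul_nonneg (entropy_nonneg s) (by positivity)
  linarith
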